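/- Let $f:\subseteq X\rightrightarrows Y$ be a multi-valued function on represented spaces. Then the following are equivalent: (1) $f\le_{\mathrm W}\mathrm{UCL}_{\mathbb R}$; (2) $f$ is limit computable with finitely many mind changes, i.e. there are a represented space $Z$ and multi-valued functions $h:\subseteq X\rightrightarrows Z$ and $g:\subseteq Z\rightrightarrows Y$ such that $h\le_{\mathrm W}\lim$, $g\le_{\mathrm W}\lim_\Delta$ and $f=g\circ h$. Moreover $\mathrm{UCL}_{\mathbb R}$ itself is limit computable with finitely many mind changes, so that it is complete for this class with respect to $\le_{\mathrm W}$. Here a represented space is a set $X$ with a partial surjection $\delta_X:\subseteq\mathbb N^{\mathbb N}\to X$ (if $\delta_X(p)=x$, then $p$ is a name of $x$); a multi-valued function $f:\subseteq X\rightrightarrows Y$ assigns to every $x\in X$ a set $f(x)\subseteq Y$ and has the domain $\mathrm{dom}(f)=\{x: f(x)\neq\emptyset\}$; and $(g\circ h)(x)=\bigcup_{z\in h(x)}g(z)$ with $\mathrm{dom}(g\circ h)=\{x\in\mathrm{dom}(h):h(x)\subseteq\mathrm{dom}(g)\}$. A realizer of $f$ is a partial function $F:\subseteq\mathbb N^{\mathbb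 N}\to\mathbb N^{\mathbb N}$ that maps every name of every $x\in\mathrm{dom}(f)$ to a name of some element of $f(x)$. We write $f\le_{\mathrm W}g$ if there are computable $K,H:\subseteq\mathbb N^{\mathbb N}\to\mathbb N^{\mathbb N}$ such that $p\mapsto K\langle p,GH(p)\rangle$ is a realizer of $f$ for every realizer $G$ of $g$, where $\langle p,q\rangle(2n)=p(n)$ and $\langle p,q\rangle(2n+1)=q(n)$. The partial functions $\lim,\lim_\Delta:\subseteq\mathbb N^{\mathbb N}\to\mathbb N^{\mathbb N}$ map $\langle p_0,p_1,p_2,\dots\rangle$ to $\lim_{i\to\infty}p_i$, where the limit is taken with respect to the product topology for $\lim$ and with respect to the discrete topology on $\mathbb N^{\mathbb N}$ for $\lim_\Delta$; here $\mathbb N^{\mathbb N}$ is represented by the identity. Finally, $\mathrm{UCL}_{\mathbb R}:\subseteq\mathbb R^{\mathbb N}\to\mathbb R$ maps every sequence of real numbers with exactly one cluster point to that cluster point, where $\mathbb R$ carries the Cauchy representation (names are sequences of rationals $(a_n)$ with $|a_n-a_k|<2^{-n}$ for all $k>n$) and $\mathbb R^{\mathbb N}$ the induced sequence representation. -/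

import Mathlib

open Filter Topology

universe u v w

namespace Weihrauch

/-- Baire space `ℕ^ℕ`, with Mathlib's product topology of the discrete topology on `ℕ`. -/
abbrev Baire : Type := ℕ → ℕ

/-- The finite prefix `p(0), …, p(n-1)` of `p`. -/
def initSeg (p : Baire) (n : ℕ) : List ℕ := (List.range n).map p

/-- The pairing `⟨p, q⟩` with `⟨p, q⟩(2n) = p(n)` and `⟨p, q⟩(2n+1) = q(n)`. -/
def pairing (p q : Baire) : Baire := fun k => if k % 2 = 0 then p (k / 2) else q (k / 2)

/-- `row p i` is the `i`-th component `p_i` of `p = ⟨p_0, p_1, p_2, …⟩`. -/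
def row (p : Baire) (i : ℕ) : Baire := fun k => p (Nat.pair i k)

/-- Computability of a partial function `F` on Baire space (Type-2 computability).
The computable word function `φ` tells which finite output word `φ u` a machine with a one-way
output tape has written after it has read the finite input word `u`; reading more of the input can
only extend the output. On every input `p` in the domain of `F` the machine writes exactly the
infinite sequence `F p`; nothing is required outside the domain. -/
def IsComputable (F : Baire →. Baire) : Prop :=
  ∃ φ : List ℕ → List ℕ, Computable φ ∧ (∀ a b, a <+: b → φ a <+: φ b) ∧
    ∀ p, ∀ q ∈ F p, ∀ n, ∃ m, initSeg q n <+: φ (initSeg p m)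

/-- A represented space: `IsName p x` says that `δ(p)` is defined and equal to `x`, for a partial
surjection `δ` from Baire space onto `X`. -/
class RepresentedSpace (X : Type u) where
  IsName : Baire → X → Prop
  eq_of_isName : ∀ {p : Baire} {x y : X}, IsName p x → IsName p y → x = y
  exists_isName : ∀ x : X, ∃ p : Baire, IsName p x

/-- A partial multi-valued function from `X` to `Y`; its domain is `{x | f x ≠ ∅}`. -/
abbrev MultiFun (X : Type u) (Y : Type v) := X → Set Y

namespace MultiFun

/-- The domain of a partial multi-valued function. -/
def dom {X : Type u} {Y : Type v} (f : MultiFun X Y) : Set X := {x | (f x).Nonempty}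

/-- The composition `g ∘ h` of multi-valued functions: `(g ∘ h)(x) = ⋃_{z ∈ h(x)} g(z)`, with domain
`{x ∈ dom h | h(x) ⊆ dom g}`. -/
def comp {X : Type u} {Z : Type w} {Y : Type v} (g : MultiFun Z Y) (h : MultiFun X Z) :
    MultiFun X Y :=
  fun x => {y | h x ⊆ g.dom ∧ ∃ z ∈ h x, y ∈ g z}

/-- The restriction of `f` to those inputs at which the value of `f` is a singleton. -/
def unique {X : Type u} {Y : Type v} (f : MultiFun X Y) : MultiFun X Y :=
  fun x => {y | f x = {y}}

end MultiFun

/-- `F` is a realizer of `f`: it maps each name of each `x ∈ dom f` to a name of an element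
of `f x`. -/
def IsRealizer {X : Type u} {Y : Type v} [RepresentedSpace X] [RepresentedSpace Y]
    (F : Baire →. Baire) (f : MultiFun X Y) : Prop :=
  ∀ p x, RepresentedSpace.IsName p x → x ∈ f.dom →
    ∃ q ∈ F p, ∃ y ∈ f x, RepresentedSpace.IsName q y

/-- Weihrauch reducibility `f ≤W g`: there are computable `K`, `H` such that
`K ⟨id, G H⟩` is a realizer of `f` for every realizer `G` of `g`. -/
def WeihrauchReducible {X Y Z W : Type*} [RepresentedSpace X] [RepresentedSpace Y]
    [RepresentedSpace Z] [RepresentedSpace W] (f : MultiFun X Y) (g : MultiFun Z W) : Prop :=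
  ∃ K H : Baire →. Baire, IsComputable K ∧ IsComputable H ∧
    ∀ G : Baire →. Baire, IsRealizer G g →
      IsRealizer (fun p => (H p).bind fun r => (G r).bind fun s => K (pairing p s)) f

/-- Baire space, represented by the identity. -/
instance : RepresentedSpace Baire where
  IsName p x := p = x
  eq_of_isName h₁ h₂ := h₁.symm.trans h₂
  exists_isName x := ⟨x, rfl⟩

/-- The limit operation on Baire space, `⟨p_0, p_1, …⟩ ↦ lim p_i`. -/
def lim : MultiFun Baire Baire := fun p => {q | Tendsto (row p) atTop (𝓝 q)}

/-- The limit operation on Baire space with respect to the discrete topology `⊥`. -/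
def limDiscrete : MultiFun Baire Baire := fun p => {q | Tendsto (row p) atTop (@nhds Baire ⊥ q)}

/-- `f` is limit computable. -/
def IsLimitComputable {X Y : Type*} [RepresentedSpace X] [RepresentedSpace Y]
    (f : MultiFun X Y) : Prop := WeihrauchReducible f lim

/-- `f` is computable with finitely many mind changes. -/
def IsFinMindChangeComputable {X Y : Type*} [RepresentedSpace X] [RepresentedSpace Y]
    (f : MultiFun X Y) : Prop := WeihrauchReducible f limDiscrete

/-- `f` is limit computable with finitely many mind changes: `f = g ∘ h` with `g` computable with
finitely many mind changes and `h` limit computable, where the represented space `Z` in the middle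
is arbitrary (in an arbitrary universe `w`). -/
def IsLimitFinMindChangeComputable {X : Type u} {Y : Type v} [RepresentedSpace X]
    [RepresentedSpace Y] (f : MultiFun X Y) : Prop :=
  ∃ (Z : Type w) (_ : RepresentedSpace Z) (g : MultiFun Z Y) (h : MultiFun X Z),
    IsFinMindChangeComputable g ∧ IsLimitComputable h ∧ f = g.comp h

/-- The standard numbering of the rationals, `⟨⟨i, j⟩, k⟩ ↦ (i - j) / (k + 1)`. -/
def ratNumbering (n : ℕ) : ℚ :=
  ((n.unpair.1.unpair.1 : ℚ) - (n.unpair.1.unpair.2 : ℚ)) / ((n.unpair.2 : ℚ) + 1)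

theorem ratNumbering_surjective : Function.Surjective ratNumbering := by
  intro q
  refine ⟨Nat.pair (Nat.pair q.num.toNat (-q.num).toNat) (q.den - 1), ?_⟩
  have h1 : ((q.num.toNat : ℚ) - ((-q.num).toNat : ℚ)) = q.num := by
    have : ((q.num.toNat : ℤ) - ((-q.num).toNat : ℤ)) = q.num := by omega
    exact_mod_cast this
  have h2 : (((q.den - 1 : ℕ) : ℚ) + 1) = q.den := by
    have : q.den - 1 + 1 = q.den := Nat.succ_pred_eq_of_pos q.den_pos
    exact_mod_cast this
  simp only [ratNumbering, Nat.unpair_pair]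
  rw [h1, h2, Rat.num_div_den]

/-- The real numbers with the Cauchy representation: a name of `x` is a sequence of (numbers of)
rationals that converges to `x` with `|a_n - a_k| < 2^{-n}` for all `k > n`. -/
instance : RepresentedSpace ℝ where
  IsName p x :=
    (∀ n k, n < k → |(ratNumbering (p n) : ℝ) - (ratNumbering (p k) : ℝ)| < (1 / 2) ^ n) ∧
      Tendsto (fun n => (ratNumbering (p n) : ℝ)) atTop (𝓝 x)
  eq_of_isName h₁ h₂ := tendsto_nhds_unique h₁.2 h₂.2
  exists_isName x := by
    have key : ∀ n : ℕ, ∃ m : ℕ, |(ratNumbering m : ℝ) - x| < (1 / 2) ^ (n + 1) := by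
      intro n
      obtain ⟨q, hq1, hq2⟩ := exists_rat_btwn
        (show x < x + (1 / 2 : ℝ) ^ (n + 1) by have : (0 : ℝ) < (1 / 2) ^ (n + 1) := by positivity
                                               linarith)
      obtain ⟨m, rfl⟩ := ratNumbering_surjective q
      exact ⟨m, by rw [abs_lt]; constructor <;> linarith⟩
    choose p hp using key
    refine ⟨p, ?_, ?_⟩
    · intro n k hnk
      have h1 := abs_lt.1 (hp n)
      have h2 := abs_lt.1 (hp k)
      have h3 : ((1 : ℝ) / 2) ^ (k + 1) ≤ (1 / 2) ^ (n + 1) :=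
        pow_le_pow_of_le_one (by norm_num) (by norm_num) (by omega)
      have h4 : ((1 : ℝ) / 2) ^ (n + 1) = (1 / 2) ^ n / 2 := by rw [pow_succ]; ring
      rw [abs_lt]
      constructor <;> linarith [h1.1, h1.2, h2.1, h2.2]
    · rw [tendsto_iff_dist_tendsto_zero]
      refine squeeze_zero (fun _ => dist_nonneg) (fun n => ?_)
        ((tendsto_pow_atTop_nhds_zero_of_lt_one (r := (1 / 2 : ℝ))
          (by norm_num) (by norm_num)).comp (tendsto_add_atTop_nat 1))
      rw [Real.dist_eq]
      exact (hp n).le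

/-- The space `X^ℕ` of sequences: `⟨p_0, p_1, …⟩` is a name of `(x_n)` if each `p_n` is a name
of `x_n`. -/
instance (X : Type u) [RepresentedSpace X] : RepresentedSpace (ℕ → X) where
  IsName p x := ∀ n, RepresentedSpace.IsName (row p n) (x n)
  eq_of_isName h₁ h₂ := funext fun n => RepresentedSpace.eq_of_isName (h₁ n) (h₂ n)
  exists_isName x := by
    choose p hp using fun n => RepresentedSpace.exists_isName (x n)
    refine ⟨fun m => p m.unpair.1 m.unpair.2, fun n => ?_⟩
    have h : row (fun m => p m.unpair.1 m.unpair.2) n = p n := by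
      funext k
      simp [row]
    rw [h]
    exact hp n

/-- The cluster point problem: a sequence is mapped to the set of its cluster points. -/
def CL (X : Type u) [TopologicalSpace X] : MultiFun (ℕ → X) X :=
  fun x => {y | MapClusterPt y atTop x}

/-- The unique cluster point problem: the restriction of the cluster point problem to the sequences
that have exactly one cluster point. -/
def UCL (X : Type u) [TopologicalSpace X] : MultiFun (ℕ → X) X := (CL X).unique

end Weihrauch

namespace Weihrauch

/-! From `UCL ℝ` to the composition: the diagonal of a name of the input is a sequence `c` of
rationals with the same unique cluster point `x`. Split the line into bounded cells by the integer
part of the absolute value. By compactness, the entries in any fixed cell are finitely many or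
converge to `x`. A limit computation therefore finds, for every cell `j` and precision `n`, an entry
close to all later entries in cell `j` (`pick`), and also the least cell visited from time `m` on
(`minCell`). The latter is nondecreasing in `m` and bounded, since `x` exists; its final value `j`
is a cell visited infinitely often. So `m ↦ pick c (minCell c m)`, as a sequence in Baire space, is
eventually constant with a name of `x` as its value: finitely many mind changes suffice
(`exists_minCell_eq`, `abs_pick_sub_le`).

From the composition `g ∘ h` to `UCL ℝ`: for a name `p`, the reduction of `h` supplies a convergent
sequence `r_n → a`, and `w = ⟨p, a⟩` computes an eventually constant sequence of rows whose limit
`g` needs. A guess `γ`, made from prefixes of `w`, for an index of a row with the final value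
stabilizes; let `c` be the least length from which it no longer changes. Then `(a, c)` determines
everything, and it is coded by the real with integer part `c` and base-4 digits the characteristic
function of the graph of `a`. As only digits 0 and 1 occur, a name of this real can be decoded.

To make this real the only cluster point, `c` is estimated at stage `n` from `u_n = ⟨p, r_n⟩`,
trusting `u_n` only as far as it agrees with `u_{n+1}`. At infinitely many "true stages" the trusted
part is a prefix of `w` and the estimate is `c`; along the remaining stages any wrong estimates tend
to infinity (`frequently_lastChange_eq`, `eventually_lastChange`). Since the estimate is the integer
part, wrong stages contribute no cluster point (`mapClusterPt_quaternary_iff`). -/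

/-! ### Calculus of computability relative to an oracle. -/

theorem length_initSeg (p : Baire) (n : ℕ) : (initSeg p n).length = n := by simp [initSeg]

theorem getElem?_initSeg (p : Baire) (n k : ℕ) :
    (initSeg p n)[k]? = if k < n then some (p k) else none := by
  by_cases h : k < n <;> simp [initSeg, h]

theorem initSeg_succ (p : Baire) (n : ℕ) : initSeg p (n + 1) = initSeg p n ++ [p n] := by
  simp [initSeg, List.range_succ]

theorem initSeg_prefix (p : Baire) {m n : ℕ} (h : m ≤ n) : initSeg p m <+: initSeg p n := by
  induction h with
  | refl => exact List.prefix_rfl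
  | step _ ih => exact ih.trans (by rw [Nat.succ_eq_add_one, initSeg_succ]; exact List.prefix_append _ _)

theorem initSeg_congr {p q : Baire} {n : ℕ} (h : ∀ k < n, p k = q k) :
    initSeg p n = initSeg q n := by
  simp only [initSeg]
  exact List.map_congr_left fun k hk => h k (List.mem_range.1 hk)

theorem prefix_getElem? {α : Type*} {a b : List α} (h : a <+: b) {k : ℕ} {y : α}
    (hk : a[k]? = some y) : b[k]? = some y := by
  obtain ⟨t, rfl⟩ := h
  rw [List.getElem?_append_left (List.getElem?_eq_some_iff.1 hk).1, hk]

/-- `T` is computable relative to its oracle argument, uniformly for oracles in `D`: a monotone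
computable function yields the values of `T` from sufficiently long prefixes of the oracle. -/
def CompOn {α β : Type*} [Primcodable α] [Primcodable β] (D : Set Baire) (T : Baire → α → β) :
    Prop :=
  ∃ ψ : List ℕ → α → Option β, Computable₂ ψ ∧
    (∀ a b x y, a <+: b → ψ a x = some y → ψ b x = some y) ∧
    ∀ p ∈ D, ∀ x, ∃ m, ψ (initSeg p m) x = some (T p x)

/-- The relation `P` is decidable relative to its oracle argument in `D`. -/
def CompPredOn {α : Type*} [Primcodable α] (D : Set Baire) (P : Baire → α → Prop) : Prop :=
  ∃ b : Baire → α → Bool, CompOn D b ∧ ∀ p ∈ D, ∀ x, b p x = true ↔ P p x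

section Calculus

variable {α β γ δ : Type*} [Primcodable α] [Primcodable β] [Primcodable γ] [Primcodable δ]
  {D E : Set Baire}

namespace CompOn

theorem congr {T T' : Baire → α → β} (hT : CompOn D T) (h : ∀ p ∈ D, ∀ x, T p x = T' p x) :
    CompOn D T' := by
  obtain ⟨ψ, h1, h2, h3⟩ := hT
  refine ⟨ψ, h1, h2, fun p hp x => ?_⟩
  rw [← h p hp x]
  exact h3 p hp x

theorem mono {T : Baire → α → β} (hT : CompOn D T) (h : E ⊆ D) : CompOn E T := by
  obtain ⟨ψ, h1, h2, h3⟩ := hT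
  exact ⟨ψ, h1, h2, fun p hp x => h3 p (h hp) x⟩

theorem of_computable {f : α → β} (hf : Computable f) : CompOn D fun _ x => f x :=
  ⟨fun _ x => some (f x), Computable.option_some.comp (hf.comp Computable.snd),
    fun _ _ _ _ _ h => h, fun _ _ _ => ⟨0, rfl⟩⟩

theorem const (y : β) : CompOn D fun _ (_ : α) => y := of_computable (Computable.const y)

theorem var : CompOn D fun _ (x : α) => x := of_computable Computable.id

theorem oracle : CompOn D fun p n => p n := by
  refine ⟨fun u n => u[n]?, Computable.list_getElem?, fun a b x y h => prefix_getElem? h,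
    fun p _ n => ⟨n + 1, ?_⟩⟩
  simp [getElem?_initSeg]

theorem comp {T : Baire → β → γ} {S : Baire → α → β} (hT : CompOn D T) (hS : CompOn D S) :
    CompOn D fun p x => T p (S p x) := by
  obtain ⟨ψ, h1, h2, h3⟩ := hT
  obtain ⟨θ, k1, k2, k3⟩ := hS
  refine ⟨fun u x => (θ u x).bind fun y => ψ u y, ?_, ?_, ?_⟩
  · exact Computable.option_bind k1
      (h1.comp (Computable.fst.comp Computable.fst) Computable.snd)
  · intro a b x z hab h
    obtain ⟨y, hy, hz⟩ := Option.bind_eq_some_iff.1 h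
    exact Option.bind_eq_some_iff.2 ⟨y, k2 a b x y hab hy, h2 a b y z hab hz⟩
  · intro p hp x
    obtain ⟨m, hm⟩ := k3 p hp x
    obtain ⟨n, hn⟩ := h3 p hp (S p x)
    exact ⟨max m n, Option.bind_eq_some_iff.2 ⟨_, k2 _ _ _ _ (initSeg_prefix p (le_max_left m n)) hm,
      h2 _ _ _ _ (initSeg_prefix p (le_max_right m n)) hn⟩⟩

theorem app {f : β → γ} {S : Baire → α → β} (hf : Computable f) (hS : CompOn D S) :
    CompOn D fun p x => f (S p x) := comp (of_computable hf) hS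

theorem pair {S : Baire → α → β} {T : Baire → α → γ} (hS : CompOn D S) (hT : CompOn D T) :
    CompOn D fun p x => (S p x, T p x) := by
  obtain ⟨ψ, h1, h2, h3⟩ := hT
  obtain ⟨θ, k1, k2, k3⟩ := hS
  refine ⟨fun u x => (θ u x).bind fun y => (ψ u x).map fun z => (y, z), ?_, ?_, ?_⟩
  · refine Computable.option_bind k1 (Computable.option_map (h1.comp
      (Computable.fst.comp Computable.fst) (Computable.snd.comp Computable.fst)) ?_)
    exact Computable.pair (Computable.snd.comp Computable.fst) Computable.snd
  · intro a b x z hab h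
    obtain ⟨y, hy, hz⟩ := Option.bind_eq_some_iff.1 h
    obtain ⟨y', hy', hz'⟩ := Option.map_eq_some_iff.1 hz
    exact Option.bind_eq_some_iff.2 ⟨y, k2 a b x y hab hy,
      Option.map_eq_some_iff.2 ⟨y', h2 a b x y' hab hy', hz'⟩⟩
  · intro p hp x
    obtain ⟨m, hm⟩ := k3 p hp x
    obtain ⟨n, hn⟩ := h3 p hp x
    exact ⟨max m n, Option.bind_eq_some_iff.2 ⟨_, k2 _ _ _ _ (initSeg_prefix p (le_max_left m n)) hm,
      Option.map_eq_some_iff.2 ⟨_, h2 _ _ _ _ (initSeg_prefix p (le_max_right m n)) hn, rfl⟩⟩⟩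

theorem app₂ {f : β → γ → δ} {S : Baire → α → β} {T : Baire → α → γ} (hf : Computable₂ f)
    (hS : CompOn D S) (hT : CompOn D T) : CompOn D fun p x => f (S p x) (T p x) :=
  comp (T := fun _ y => f y.1 y.2) (of_computable hf) (pair hS hT)

theorem query {S : Baire → α → ℕ} (hS : CompOn D S) : CompOn D fun p x => p (S p x) :=
  comp oracle hS

theorem fst {S : Baire → α → β × γ} (hS : CompOn D S) : CompOn D fun p x => (S p x).1 :=
  app Computable.fst hS

theorem snd {S : Baire → α → β × γ} (hS : CompOn D S) : CompOn D fun p x => (S p x).2 :=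
  app Computable.snd hS

theorem natRec {f : Baire → α → β} {g : Baire → α × ℕ × β → β} {n : Baire → α → ℕ}
    (hf : CompOn D f) (hg : CompOn D g) (hn : CompOn D n) :
    CompOn D fun p x => Nat.rec (motive := fun _ => β) (f p x) (fun k y => g p (x, k, y)) (n p x) := by
  suffices h : CompOn D fun p (z : α × ℕ) =>
      Nat.rec (motive := fun _ => β) (f p z.1) (fun k y => g p (z.1, k, y)) z.2 from
    comp (S := fun p x => (x, n p x)) h (pair var hn)
  obtain ⟨ψ, h1, h2, h3⟩ := hf
  obtain ⟨θ, k1, k2, k3⟩ := hg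
  refine ⟨fun u z => Nat.rec (motive := fun _ => Option β) (ψ u z.1)
    (fun k y => y.bind fun y => θ u (z.1, k, y)) z.2, ?_, ?_, ?_⟩
  · refine Computable.nat_rec (f := fun a : List ℕ × α × ℕ => a.2.2)
      (g := fun a : List ℕ × α × ℕ => ψ a.1 a.2.1)
      (h := fun (a : List ℕ × α × ℕ) (b : ℕ × Option β) => b.2.bind fun y => θ a.1 (a.2.1, b.1, y))
      (Computable.snd.comp Computable.snd)
      (h1.comp Computable.fst (Computable.fst.comp Computable.snd)) ?_
    refine Computable.option_bind (Computable.snd.comp Computable.snd) ?_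
    refine k1.comp (Computable.fst.comp (Computable.fst.comp Computable.fst)) ?_
    exact Computable.pair
      (Computable.fst.comp (Computable.snd.comp (Computable.fst.comp Computable.fst)))
      (Computable.pair (Computable.fst.comp (Computable.snd.comp Computable.fst)) Computable.snd)
  · rintro a b ⟨x, k⟩ y hab
    dsimp only
    induction k generalizing y with
    | zero => exact h2 a b x y hab
    | succ k ih =>
      intro h
      obtain ⟨y', hy', hz⟩ := Option.bind_eq_some_iff.1 h
      exact Option.bind_eq_some_iff.2 ⟨y', ih y' hy', k2 _ _ _ _ hab hz⟩
  · rintro p hp ⟨x, k⟩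
    dsimp only
    -- The claim is made for all longer prefixes, so that the recursion and its next step can share
    -- one prefix.
    have key : ∃ m, ∀ n ≥ m, Nat.rec (motive := fun _ => Option β) (ψ (initSeg p n) x)
        (fun k y => y.bind fun y => θ (initSeg p n) (x, k, y)) k =
        some (Nat.rec (motive := fun _ => β) (f p x) (fun k y => g p (x, k, y)) k) := by
      induction k with
      | zero =>
        obtain ⟨m, hm⟩ := h3 p hp x
        exact ⟨m, fun n hn => h2 _ _ _ _ (initSeg_prefix p hn) hm⟩
      | succ k ih =>
        obtain ⟨m, hm⟩ := ih
        obtain ⟨m', hm'⟩ := k3 p hp (x, k,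
          Nat.rec (motive := fun _ => β) (f p x) (fun k y => g p (x, k, y)) k)
        refine ⟨max m m', fun n hn => Option.bind_eq_some_iff.2
          ⟨_, hm n (le_of_max_le_left hn), ?_⟩⟩
        exact k2 _ _ _ _ (initSeg_prefix p (le_of_max_le_right hn)) hm'
    obtain ⟨m, hm⟩ := key
    exact ⟨m, hm m le_rfl⟩

theorem ite {P : Baire → α → Prop} {S T : Baire → α → β} (hP : CompPredOn D P)
    (hS : CompOn D S) (hT : CompOn D T) [∀ p x, Decidable (P p x)] :
    CompOn D fun p x => if P p x then S p x else T p x := by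
  obtain ⟨b, hb, hb'⟩ := hP
  have hc : Computable fun z : Bool × β × β => bif z.1 then z.2.1 else z.2.2 :=
    Computable.cond Computable.fst (Computable.fst.comp Computable.snd)
      (Computable.snd.comp Computable.snd)
  refine (app hc (pair hb (pair hS hT))).congr fun p hp x => ?_
  have := hb' p hp x
  by_cases h : P p x
  · simp [h, this.2 h]
  · have h' : b p x = false := by
      rw [← Bool.not_eq_true, this]; exact h
    simp [h, h']

theorem add {S T : Baire → α → ℕ} (hS : CompOn D S) (hT : CompOn D T) :
    CompOn D fun p x => S p x + T p x := app₂ Primrec.nat_add.to_comp hS hT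

theorem sub {S T : Baire → α → ℕ} (hS : CompOn D S) (hT : CompOn D T) :
    CompOn D fun p x => S p x - T p x := app₂ Primrec.nat_sub.to_comp hS hT

theorem mul {S T : Baire → α → ℕ} (hS : CompOn D S) (hT : CompOn D T) :
    CompOn D fun p x => S p x * T p x := app₂ Primrec.nat_mul.to_comp hS hT

theorem div {S T : Baire → α → ℕ} (hS : CompOn D S) (hT : CompOn D T) :
    CompOn D fun p x => S p x / T p x := app₂ Primrec.nat_div.to_comp hS hT

theorem mod {S T : Baire → α → ℕ} (hS : CompOn D S) (hT : CompOn D T) :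
    CompOn D fun p x => S p x % T p x := app₂ Primrec.nat_mod.to_comp hS hT

theorem pow {S T : Baire → α → ℕ} (hS : CompOn D S) (hT : CompOn D T) :
    CompOn D fun p x => S p x ^ T p x :=
  app₂ (Primrec₂.unpaired'.1 Nat.Primrec.pow).to_comp hS hT

theorem natPair {S T : Baire → α → ℕ} (hS : CompOn D S) (hT : CompOn D T) :
    CompOn D fun p x => Nat.pair (S p x) (T p x) := app₂ Primrec₂.natPair.to_comp hS hT

theorem unpairFst {S : Baire → α → ℕ} (hS : CompOn D S) :
    CompOn D fun p x => (S p x).unpair.1 := fst (app Computable.unpair hS)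

theorem unpairSnd {S : Baire → α → ℕ} (hS : CompOn D S) :
    CompOn D fun p x => (S p x).unpair.2 := snd (app Computable.unpair hS)

theorem segment {T : Baire → α → Baire} {n : Baire → α → ℕ}
    (hT : CompOn D fun p (z : α × ℕ) => T p z.1 z.2) (hn : CompOn D n) :
    CompOn D fun p x => initSeg (T p x) (n p x) := by
  have h := natRec (f := fun _ (_ : α) => ([] : List ℕ))
    (g := fun p z => z.2.2 ++ [T p z.1 z.2.1]) (n := n) (D := D) (const [])
    (app₂ (f := fun (l : List ℕ) (a : ℕ) => l ++ [a]) Computable.list_concat (snd (snd var))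
      (comp hT (pair (fst var) (fst (snd var))))) hn
  refine h.congr fun p _ x => ?_
  induction n p x with
  | zero => rfl
  | succ k ih => rw [initSeg_succ, ← ih]

end CompOn

namespace CompPredOn

theorem congr {P P' : Baire → α → Prop} (hP : CompPredOn D P)
    (h : ∀ p ∈ D, ∀ x, P p x ↔ P' p x) : CompPredOn D P' := by
  obtain ⟨b, h1, h2⟩ := hP
  exact ⟨b, h1, fun p hp x => (h2 p hp x).trans (h p hp x)⟩

theorem le {S T : Baire → α → ℕ} (hS : CompOn D S) (hT : CompOn D T) :
    CompPredOn D fun p x => S p x ≤ T p x :=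
  ⟨fun p x => decide (S p x ≤ T p x),
    CompOn.app₂ (f := fun a b : ℕ => decide (a ≤ b)) Primrec.nat_le.decide.to_comp hS hT,
    fun _ _ _ => decide_eq_true_iff⟩

theorem eq [DecidableEq β] {S T : Baire → α → β} (hS : CompOn D S) (hT : CompOn D T) :
    CompPredOn D fun p x => S p x = T p x :=
  ⟨fun p x => decide (S p x = T p x),
    CompOn.app₂ (f := fun a b : β => decide (a = b)) Primrec.eq.decide.to_comp hS hT,
    fun _ _ _ => decide_eq_true_iff⟩

theorem not {P : Baire → α → Prop} (hP : CompPredOn D P) : CompPredOn D fun p x => ¬ P p x := by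
  obtain ⟨b, h1, h2⟩ := hP
  refine ⟨fun p x => !b p x, CompOn.app Primrec.not.to_comp h1, fun p hp x => ?_⟩
  simp [← h2 p hp x]

theorem and {P Q : Baire → α → Prop} (hP : CompPredOn D P) (hQ : CompPredOn D Q) :
    CompPredOn D fun p x => P p x ∧ Q p x := by
  obtain ⟨b, h1, h2⟩ := hP
  obtain ⟨c, k1, k2⟩ := hQ
  refine ⟨fun p x => b p x && c p x, CompOn.app₂ (f := fun a b : Bool => a && b) Primrec.and.to_comp h1 k1, fun p hp x => ?_⟩
  simp [← h2 p hp x, ← k2 p hp x]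

theorem or {P Q : Baire → α → Prop} (hP : CompPredOn D P) (hQ : CompPredOn D Q) :
    CompPredOn D fun p x => P p x ∨ Q p x :=
  (hP.not.and hQ.not).not.congr fun p _ x => by tauto

theorem imp {P Q : Baire → α → Prop} (hP : CompPredOn D P) (hQ : CompPredOn D Q) :
    CompPredOn D fun p x => P p x → Q p x :=
  (hP.and hQ.not).not.congr fun p _ x => by tauto

theorem forall_lt {P : Baire → α → ℕ → Prop} {n : Baire → α → ℕ}
    (hP : CompPredOn D fun p (z : α × ℕ) => P p z.1 z.2) (hn : CompOn D n) :
    CompPredOn D fun p x => ∀ k < n p x, P p x k := by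
  obtain ⟨b, h1, h2⟩ := hP
  refine ⟨_, CompOn.natRec (f := fun _ (_ : α) => true)
    (g := fun p z => z.2.2 && b p (z.1, z.2.1)) (n := n) (CompOn.const true)
    (CompOn.app₂ (f := fun a b : Bool => a && b) Primrec.and.to_comp (CompOn.snd (CompOn.snd CompOn.var))
      (h1.comp (CompOn.pair (CompOn.fst CompOn.var) (CompOn.fst (CompOn.snd CompOn.var))))) hn,
    fun p hp x => ?_⟩
  dsimp only
  induction n p x with
  | zero => simp
  | succ k ih =>
    rw [Bool.and_eq_true, ih, h2 p hp (x, k)]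
    exact ⟨fun h i hi => (Nat.lt_succ_iff_lt_or_eq.1 hi).elim (h.1 i) fun e => e ▸ h.2,
      fun h => ⟨fun i hi => h i (Nat.lt_succ_of_lt hi), h k (Nat.lt_succ_self k)⟩⟩

theorem forall_le {P : Baire → α → ℕ → Prop} {n : Baire → α → ℕ}
    (hP : CompPredOn D fun p (z : α × ℕ) => P p z.1 z.2) (hn : CompOn D n) :
    CompPredOn D fun p x => ∀ k ≤ n p x, P p x k :=
  (forall_lt (n := fun p x => n p x + 1) hP (hn.add (CompOn.const 1))).congr fun p _ x => by
    simp only [Nat.lt_succ_iff]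

theorem exists_le {P : Baire → α → ℕ → Prop} {n : Baire → α → ℕ}
    (hP : CompPredOn D fun p (z : α × ℕ) => P p z.1 z.2) (hn : CompOn D n) :
    CompPredOn D fun p x => ∃ k ≤ n p x, P p x k :=
  (forall_le (P := fun p x k => ¬ P p x k) hP.not hn).not.congr fun p _ x => by
    push Not; rfl

end CompPredOn

/-- Unbounded search. On a finite prefix it is run with the length of the prefix as fuel, which
keeps the word function total; monotonicity holds because an answer is given only after all smaller
candidates have been refuted. -/
theorem CompOn.least {P : Baire → α → ℕ → Prop}
    (hP : CompPredOn D fun p (z : α × ℕ) => P p z.1 z.2) (hex : ∀ p ∈ D, ∀ x, ∃ n, P p x n) :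
    CompOn D fun p x => sInf {n | P p x n} := by
  obtain ⟨b, ⟨ψ, h1, h2, h3⟩, hb⟩ := hP
  -- A counter that advances past refuted candidates and stays at the first one that is confirmed or
  -- undecided.
  let halt : List ℕ → α → ℕ → ℕ := fun u x N => Nat.rec (motive := fun _ => ℕ) 0
    (fun _ s => bif decide (ψ u (x, s) = some false) then s + 1 else s) N
  have halt_spec : ∀ u x N, (∀ k < halt u x N, ψ u (x, k) = some false) ∧
      (halt u x N = N ∨ (halt u x N ≤ N ∧ ψ u (x, halt u x N) ≠ some false)) := by
    intro u x N
    induction N with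
    | zero => exact ⟨fun k hk => absurd hk (Nat.not_lt_zero k), Or.inl rfl⟩
    | succ N ih =>
      have e : halt u x (N + 1) = bif decide (ψ u (x, halt u x N) = some false)
        then halt u x N + 1 else halt u x N := rfl
      by_cases hs : ψ u (x, halt u x N) = some false
      · rw [e]
        simp only [hs, decide_true, cond_true]
        have hN : halt u x N = N := ih.2.resolve_right fun h => h.2 hs
        refine ⟨fun k hk => ?_, Or.inl (by rw [hN])⟩
        rcases Nat.lt_succ_iff_lt_or_eq.1 hk with hk | rfl
        · exact ih.1 k hk
        · exact hs
      · rw [e]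
        simp only [hs, decide_false, cond_false]
        refine ⟨ih.1, Or.inr ⟨?_, hs⟩⟩
        rcases ih.2 with h | h <;> omega
  have halt_eq : ∀ u x N s, s ≤ N → (∀ k < s, ψ u (x, k) = some false) →
      ψ u (x, s) = some true → halt u x N = s := by
    intro u x N s hs hk ht
    obtain ⟨g1, g2⟩ := halt_spec u x N
    rcases lt_trichotomy (halt u x N) s with h | h | h
    · rcases g2 with g2 | g2
      · omega
      · exact absurd (hk _ h) g2.2
    · exact h
    · have := g1 s h
      rw [ht] at this
      simp at this
  refine ⟨fun u x => bif decide (ψ u (x, halt u x u.length) = some true)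
    then some (halt u x u.length) else none, ?_, ?_, ?_⟩
  · have hhalt : Computable fun z : List ℕ × α => halt z.1 z.2 z.1.length := by
      refine Computable.nat_rec (f := fun z : List ℕ × α => z.1.length) (g := fun _ => 0)
        (h := fun (z : List ℕ × α) (y : ℕ × ℕ) =>
          bif decide (ψ z.1 (z.2, y.2) = some false) then y.2 + 1 else y.2)
        (Computable.list_length.comp Computable.fst) (Computable.const 0) ?_
      have hc : Computable fun y : (List ℕ × α) × ℕ × ℕ => y.2.2 := Computable.snd.comp Computable.snd
      refine Computable.cond ?_ (Computable.succ.comp hc) hc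
      refine (Primrec.eq (α := Option Bool)).decide.to_comp.comp (h1.comp (Computable.fst.comp Computable.fst)
        (Computable.pair (Computable.snd.comp Computable.fst) hc)) (Computable.const _)
    refine Computable.cond ?_ (Computable.option_some.comp hhalt) (Computable.const none)
    exact (Primrec.eq (α := Option Bool)).decide.to_comp.comp (h1.comp Computable.fst (Computable.pair Computable.snd hhalt))
      (Computable.const _)
  · intro u v x y huv h
    by_cases ht : ψ u (x, halt u x u.length) = some true
    · simp only [ht, decide_true, cond_true, Option.some.injEq] at h
      obtain ⟨g1, g2⟩ := halt_spec u x u.length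
      have e : halt v x v.length = halt u x u.length := by
        refine halt_eq v x _ _ ?_ (fun k hk => h2 u v _ _ huv (g1 k hk)) (h2 u v _ _ huv ht)
        have := huv.length_le
        rcases g2 with g | g <;> omega
      dsimp only
      rw [e, decide_eq_true (h2 u v _ _ huv ht), cond_true, h]
    · simp [ht] at h
  · intro p hp x
    have hmem : b p (x, sInf {n | P p x n}) = true := (hb p hp _).2 (Nat.sInf_mem (hex p hp x))
    have hlt : ∀ k < sInf {n | P p x n}, b p (x, k) = false := fun k hk => by
      rw [← Bool.not_eq_true, hb p hp]
      exact Nat.notMem_of_lt_sInf hk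
    choose m hm using fun k => h3 p hp (x, k)
    set s := sInf {n | P p x n}
    let M := max s ((Finset.range (s + 1)).sup m)
    have hM : ∀ k ≤ s, ψ (initSeg p M) (x, k) = some (b p (x, k)) := fun k hk =>
      h2 _ _ _ _ (initSeg_prefix p ((Finset.le_sup (f := m)
        (Finset.mem_range.2 (Nat.lt_succ_of_le hk))).trans (le_max_right _ _))) (hm k)
    have e : halt (initSeg p M) x (initSeg p M).length = s :=
      halt_eq _ x _ s (by rw [length_initSeg]; exact le_max_left _ _)
        (fun k hk => by rw [hM k hk.le, hlt k hk]) (by rw [hM s le_rfl, hmem])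
    refine ⟨M, ?_⟩
    simp only [e, hM s le_rfl, hmem, decide_true, cond_true]
    rfl

end Calculus

/-! ### Computable functions on Baire space, and pairing. -/

theorem CompOn.exists_word {D : Set Baire} {S : Baire → Baire} (hS : CompOn D S) :
    ∃ φ : List ℕ → List ℕ, Computable φ ∧ (∀ a b, a <+: b → φ a <+: φ b) ∧
      ∀ p ∈ D, ∀ n, ∃ m, initSeg (S p) n <+: φ (initSeg p m) := by
  obtain ⟨ψ, h1, h2, h3⟩ := hS
  -- Each round appends the value at the next output position if it is already known; after the
  -- first unknown value the word stays fixed.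
  let out : List ℕ → ℕ → List ℕ := fun u N => Nat.rec (motive := fun _ => List ℕ) []
    (fun _ l => l ++ (ψ u l.length).toList) N
  have out_succ : ∀ u N, out u (N + 1) = out u N ++ (ψ u (out u N).length).toList :=
    fun _ _ => rfl
  have out_spec : ∀ u N, (∀ k y, (out u N)[k]? = some y → ψ u k = some y) ∧
      (out u N).length ≤ N ∧ ((out u N).length = N ∨ ψ u (out u N).length = none) := by
    intro u N
    induction N with
    | zero => exact ⟨fun k y hk => by simp [out] at hk, le_rfl, Or.inl rfl⟩
    | succ N ih =>
      obtain ⟨i1, i2, i3⟩ := ih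
      rw [out_succ]
      cases hy : ψ u (out u N).length with
      | none => simpa [hy] using ⟨i1, Nat.le_succ_of_le i2⟩
      | some y =>
        have e : (out u N).length = N := i3.resolve_right (by simp [hy])
        refine ⟨fun k z hk => ?_, by simp [e], Or.inl (by simp [e])⟩
        rw [List.getElem?_append] at hk
        split_ifs at hk with hlt
        · exact i1 k z hk
        · simp only [Option.toList_some, List.getElem?_singleton] at hk
          split_ifs at hk with h0
          have hk' : k = (out u N).length := by omega
          rw [hk', hy, hk]
  have out_prefix : ∀ u v N M, u <+: v → N ≤ M → out u N <+: out v M := by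
    intro u v N M huv hNM
    obtain ⟨a1, a2, a3⟩ := out_spec u N
    obtain ⟨b1, b2, b3⟩ := out_spec v M
    have hlen : (out u N).length ≤ (out v M).length := by
      by_contra hlt
      push Not at hlt
      obtain ⟨y, hy⟩ : ∃ y, (out u N)[(out v M).length]? = some y :=
        ⟨_, List.getElem?_eq_getElem hlt⟩
      have hv := h2 _ _ _ _ huv (a1 _ _ hy)
      rcases b3 with b3 | b3
      · omega
      · simp [hv] at b3
    rw [List.prefix_iff_getElem?]
    intro i hi
    have e1 := h2 _ _ _ _ huv (a1 i _ (List.getElem?_eq_getElem hi))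
    have e2 := b1 i _ (List.getElem?_eq_getElem (hi.trans_le hlen))
    rw [List.getElem?_eq_getElem (hi.trans_le hlen), ← e2, e1]
  have out_eq : ∀ p ∈ D, ∀ u N, (∀ k < N, ψ u k = some (S p k)) → out u N = initSeg (S p) N := by
    intro p _ u N
    induction N with
    | zero => intro _; rfl
    | succ N ih =>
      intro h
      rw [out_succ, ih fun k hk => h k (Nat.lt_succ_of_lt hk), length_initSeg, h N N.lt_succ_self,
        initSeg_succ]
      rfl
  refine ⟨fun u => out u u.length, ?_, fun a b hab => out_prefix _ _ _ _ hab hab.length_le, ?_⟩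
  · refine Computable.nat_rec (f := fun u : List ℕ => u.length) (g := fun _ => [])
      (h := fun (u : List ℕ) (y : ℕ × List ℕ) => y.2 ++ (ψ u y.2.length).toList)
      Computable.list_length (Computable.const []) ?_
    have hl : Computable fun z : List ℕ × ℕ × List ℕ => z.2.2 := Computable.snd.comp Computable.snd
    have ht : Computable fun o : Option ℕ => o.toList := by
      refine (Computable.option_casesOn (o := fun o : Option ℕ => o) (f := fun _ => ([] : List ℕ))
        (g := fun _ y => [y]) Computable.id (Computable.const [])
        (Computable.list_cons.comp Computable.snd (Computable.const []))).of_eq fun o => ?_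
      cases o <;> rfl
    exact Computable.list_append.comp hl
      (ht.comp (h1.comp Computable.fst (Computable.list_length.comp hl)))
  · intro p hp n
    choose m hm using fun k => h3 p hp k
    let M := max n ((Finset.range n).sup m)
    refine ⟨M, ?_⟩
    have e := out_eq p hp (initSeg p M) n fun k hk => h2 _ _ _ _ (initSeg_prefix p
      ((Finset.le_sup (f := m) (Finset.mem_range.2 hk)).trans (le_max_right _ _))) (hm k)
    rw [← e]
    exact out_prefix _ _ _ _ List.prefix_rfl (by rw [length_initSeg]; exact le_max_left _ _)

theorem CompOn.isComputable {D : Set Baire} {S : Baire → Baire} (hS : CompOn D S) :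
    IsComputable fun p => ⟨p ∈ D, fun _ => S p⟩ := by
  obtain ⟨φ, h1, h2, h3⟩ := hS.exists_word
  refine ⟨φ, h1, h2, fun p q hq n => ?_⟩
  obtain ⟨hp, rfl⟩ := hq
  exact h3 p hp n

theorem compOn_of_word {D : Set Baire} {S : Baire → Baire} {φ : List ℕ → List ℕ}
    (h1 : Computable φ) (h2 : ∀ a b, a <+: b → φ a <+: φ b)
    (h3 : ∀ p ∈ D, ∀ n, ∃ m, initSeg (S p) n <+: φ (initSeg p m)) : CompOn D S := by
  refine ⟨fun u n => (φ u)[n]?, Computable.list_getElem?.comp (h1.comp Computable.fst) Computable.snd,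
    fun a b x y hab h => prefix_getElem? (h2 a b hab) h, fun p hp n => ?_⟩
  obtain ⟨m, hm⟩ := h3 p hp (n + 1)
  exact ⟨m, prefix_getElem? hm (by simp [getElem?_initSeg])⟩

theorem IsComputable.compOn {F : Baire →. Baire} (hF : IsComputable F) {D : Set Baire}
    {S : Baire → Baire} (h : ∀ p ∈ D, S p ∈ F p) : CompOn D S := by
  obtain ⟨φ, h1, h2, h3⟩ := hF
  exact compOn_of_word h1 h2 fun p hp => h3 p _ (h p hp)

/-- Composition of computable functions on Baire space. -/
theorem CompOn.comp_baire {D E : Set Baire} {S T : Baire → Baire} (hT : CompOn E T)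
    (hS : CompOn D S) (h : Set.MapsTo S D E) : CompOn D fun p => T (S p) := by
  obtain ⟨φ, a1, a2, a3⟩ := hS.exists_word
  obtain ⟨θ, b1, b2, b3⟩ := hT.exists_word
  refine compOn_of_word (b1.comp a1) (fun a b hab => b2 _ _ (a2 _ _ hab)) fun p hp n => ?_
  obtain ⟨m, hm⟩ := b3 (S p) (h hp) n
  obtain ⟨k, hk⟩ := a3 p hp m
  exact ⟨k, hm.trans (b2 _ _ hk)⟩

/-- An everywhere defined function that agrees with `F` on its domain. -/
noncomputable def total (F : Baire →. Baire) (p : Baire) : Baire :=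
  open Classical in if h : (F p).Dom then (F p).get h else p

theorem total_eq {F : Baire →. Baire} {p q : Baire} (h : q ∈ F p) : total F p = q := by
  obtain ⟨hd, rfl⟩ := h
  simp [total, hd]

theorem IsComputable.compOn_total {F : Baire →. Baire} (hF : IsComputable F) :
    CompOn {p | (F p).Dom} (total F) :=
  hF.compOn fun p hp => by
    rw [total_eq (Part.get_mem (o := F p) hp)]
    exact Part.get_mem _

theorem pairing_even (p q : Baire) (n : ℕ) : pairing p q (2 * n) = p n := by
  simp [pairing]

theorem pairing_odd (p q : Baire) (n : ℕ) : pairing p q (2 * n + 1) = q n := by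
  have h : (2 * n + 1) / 2 = n := by omega
  simp [pairing, h]

theorem pairing_injective {p q p' q' : Baire} (h : pairing p q = pairing p' q') :
    p = p' ∧ q = q' :=
  ⟨funext fun n => by rw [← pairing_even p q n, h, pairing_even],
    funext fun n => by rw [← pairing_odd p q n, h, pairing_odd]⟩

/-- The even half of an element of Baire space. -/
def left (p : Baire) : Baire := fun n => p (2 * n)

/-- The odd half of an element of Baire space. -/
def right (p : Baire) : Baire := fun n => p (2 * n + 1)

@[simp] theorem left_pairing (p q : Baire) : left (pairing p q) = p :=
  funext fun n => pairing_even p q n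

@[simp] theorem right_pairing (p q : Baire) : right (pairing p q) = q :=
  funext fun n => pairing_odd p q n

section

variable {α : Type*} [Primcodable α] {D : Set Baire}

theorem CompOn.left {S : Baire → α → ℕ} (hS : CompOn D S) :
    CompOn D fun p x => left p (S p x) := ((CompOn.const 2).mul hS).query

theorem CompOn.right {S : Baire → α → ℕ} (hS : CompOn D S) :
    CompOn D fun p x => right p (S p x) := (((CompOn.const 2).mul hS).add (CompOn.const 1)).query

theorem CompOn.pairing {S T : Baire → α → Baire} {k : Baire → α → ℕ}
    (hS : CompOn D fun p (z : α × ℕ) => S p z.1 z.2)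
    (hT : CompOn D fun p (z : α × ℕ) => T p z.1 z.2) (hk : CompOn D k) :
    CompOn D fun p x => pairing (S p x) (T p x) (k p x) := by
  have h2 := hk.div (CompOn.const 2)
  exact CompOn.ite (CompPredOn.eq (hk.mod (CompOn.const 2)) (CompOn.const 0))
    (hS.comp (CompOn.var.pair h2)) (hT.comp (CompOn.var.pair h2))

end

theorem CompOn.pairing_baire {D : Set Baire} {S T : Baire → Baire} (hS : CompOn D S)
    (hT : CompOn D T) : CompOn D fun p => Weihrauch.pairing (S p) (T p) :=
  CompOn.pairing (S := fun p _ => S p) (T := fun p _ => T p) (k := fun _ n => n)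
    (hS.comp (CompOn.snd CompOn.var)) (hT.comp (CompOn.snd CompOn.var)) CompOn.var

/-! ### Weihrauch reducibility without realizers. -/

/-- A realizer that is undefined off the names of points of `g.dom` forces `H p` to be such a name.
Changing its value at that single name shows that `K` must cope with every admissible answer. -/
theorem weihrauchReducible_iff {X Y Z W : Type*} [RepresentedSpace X] [RepresentedSpace Y]
    [RepresentedSpace Z] [RepresentedSpace W] {f : MultiFun X Y} {g : MultiFun Z W} :
    WeihrauchReducible f g ↔ ∃ K H : Baire →. Baire, IsComputable K ∧ IsComputable H ∧
      ∀ p x, RepresentedSpace.IsName p x → x ∈ f.dom → ∃ r ∈ H p, ∃ z ∈ g.dom,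
        RepresentedSpace.IsName r z ∧ ∀ s, ∀ t ∈ g z, RepresentedSpace.IsName s t →
          ∃ q ∈ K (pairing p s), ∃ y ∈ f x, RepresentedSpace.IsName q y := by
  constructor
  · rintro ⟨K, H, hK, hH, h⟩
    refine ⟨K, H, hK, hH, fun p x hp hx => ?_⟩
    have hG : ∀ r z, RepresentedSpace.IsName r z → z ∈ g.dom →
        ∃ s, ∃ t ∈ g z, RepresentedSpace.IsName s t := fun r z _ hz => by
      obtain ⟨t, ht⟩ := hz
      obtain ⟨s, hs⟩ := RepresentedSpace.exists_isName t
      exact ⟨s, t, ht, hs⟩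
    choose! G hG using hG
    let G₀ : Baire →. Baire := fun r => ⟨∃ z, RepresentedSpace.IsName r z ∧ z ∈ g.dom,
      fun h => G r h.choose⟩
    have hG₀ : IsRealizer G₀ g := by
      intro r z hr hz
      have hd : ∃ z, RepresentedSpace.IsName r z ∧ z ∈ g.dom := ⟨z, hr, hz⟩
      have e : hd.choose = z := RepresentedSpace.eq_of_isName hd.choose_spec.1 hr
      refine ⟨G r hd.choose, ⟨hd, rfl⟩, ?_⟩
      rw [e]
      exact hG r z hr hz
    obtain ⟨q, hq, -⟩ := h G₀ hG₀ p x hp hx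
    obtain ⟨r, hr, hq⟩ := Part.mem_bind_iff.1 hq
    obtain ⟨_, ⟨⟨z, hz, hzd⟩, -⟩, -⟩ := Part.mem_bind_iff.1 hq
    refine ⟨r, hr, z, hzd, hz, fun s t ht hs => ?_⟩
    let G₁ : Baire →. Baire := fun r' => open Classical in if r' = r then Part.some s else G₀ r'
    have hG₁ : IsRealizer G₁ g := by
      intro r' z' hr' hz'
      by_cases e : r' = r
      · subst e
        rw [RepresentedSpace.eq_of_isName hr' hz]
        exact ⟨s, by simp [G₁], t, ht, hs⟩
      · simpa [G₁, e] using hG₀ r' z' hr' hz'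
    obtain ⟨q, hq, hq'⟩ := h G₁ hG₁ p x hp hx
    obtain ⟨r', hr', hq⟩ := Part.mem_bind_iff.1 hq
    obtain rfl := Part.mem_unique hr' hr
    obtain ⟨s', hs', hq⟩ := Part.mem_bind_iff.1 hq
    have e : s' = s := by simpa [G₁] using hs'
    exact ⟨q, e ▸ hq, hq'⟩
  · rintro ⟨K, H, hK, hH, h⟩
    refine ⟨K, H, hK, hH, fun G hG p x hp hx => ?_⟩
    obtain ⟨r, hr, z, hz, hrz, hK'⟩ := h p x hp hx
    obtain ⟨s, hs, t, ht, hst⟩ := hG r z hrz hz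
    obtain ⟨q, hq, hq'⟩ := hK' s t ht hst
    exact ⟨q, Part.mem_bind_iff.2 ⟨r, hr, Part.mem_bind_iff.2 ⟨s, hs, hq⟩⟩, hq'⟩

/-! ### Limits in Baire space and of minima. -/

theorem tendsto_baire_iff {u : ℕ → Baire} {q : Baire} :
    Tendsto u atTop (𝓝 q) ↔ ∀ k, ∀ᶠ n in atTop, u n k = q k := by
  simp only [tendsto_pi_nhds, nhds_discrete, tendsto_pure]

theorem tendsto_discrete_iff {u : ℕ → Baire} {q : Baire} :
    Tendsto u atTop (@nhds Baire ⊥ q) ↔ ∀ᶠ n in atTop, u n = q := by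
  have h : @nhds Baire ⊥ q = pure q :=
    congrFun (@nhds_discrete Baire ⊥ (@DiscreteTopology.mk Baire ⊥ rfl)) q
  rw [h, tendsto_pure]

/-- Only finitely many numbers lie below the least element of the intersection, and each leaves the
sets at some stage. This is the source of every "finitely many changes" argument about decreasing
sets of candidates. -/
theorem eventually_sInf_eq_of_antitone {S : ℕ → Set ℕ} (hS : Antitone S)
    (hne : (⋂ t, S t).Nonempty) : ∀ᶠ t in atTop, sInf (S t) = sInf (⋂ t, S t) := by
  have h : ∀ k < sInf (⋂ t, S t), ∀ᶠ t in atTop, k ∉ S t := by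
    intro k hk
    have := Nat.notMem_of_lt_sInf hk
    simp only [Set.mem_iInter, not_forall] at this
    obtain ⟨t, ht⟩ := this
    filter_upwards [eventually_ge_atTop t] with s hs hks using ht (hS hs hks)
  have h' := (Set.finite_Iio (sInf (⋂ t, S t))).eventually_all.2 h
  filter_upwards [h'] with t ht
  have hm : sInf (⋂ t, S t) ∈ S t := Set.mem_iInter.1 (Nat.sInf_mem hne) t
  refine le_antisymm (Nat.sInf_le hm) ?_
  by_contra hlt
  exact ht _ (not_le.1 hlt) (Nat.sInf_mem ⟨_, hm⟩)

theorem eventually_sInf_eq_of_monotone {S : ℕ → Set ℕ} (hS : Monotone S)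
    (hne : (⋃ t, S t).Nonempty) : ∀ᶠ t in atTop, sInf (S t) = sInf (⋃ t, S t) := by
  obtain ⟨t, ht⟩ := Set.mem_iUnion.1 (Nat.sInf_mem hne)
  filter_upwards [eventually_ge_atTop t] with s hs
  exact le_antisymm (Nat.sInf_le (hS hs ht))
    (Nat.sInf_le (Set.mem_iUnion.2 ⟨s, Nat.sInf_mem ⟨_, hS hs ht⟩⟩))

/-! ### Arithmetic of rational codes: cells and closeness. -/

/-- The integer part of the absolute value of the rational number with the given code. -/
def cell (a : ℕ) : ℕ :=
  ((a.unpair.1.unpair.1 - a.unpair.1.unpair.2) + (a.unpair.1.unpair.2 - a.unpair.1.unpair.1)) /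
    (a.unpair.2 + 1)

theorem cast_sub_add_sub (a b : ℕ) : (((a - b) + (b - a) : ℕ) : ℝ) = |(a : ℝ) - b| := by
  rcases le_total a b with h | h
  · rw [Nat.sub_eq_zero_of_le h, zero_add, Nat.cast_sub h, abs_sub_comm, abs_of_nonneg]
    exact sub_nonneg.2 (Nat.cast_le.2 h)
  · rw [Nat.sub_eq_zero_of_le h, add_zero, Nat.cast_sub h, abs_of_nonneg]
    exact sub_nonneg.2 (Nat.cast_le.2 h)

theorem abs_ratNumbering (a : ℕ) : |(ratNumbering a : ℝ)| =
    (((a.unpair.1.unpair.1 - a.unpair.1.unpair.2) + (a.unpair.1.unpair.2 - a.unpair.1.unpair.1) :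
      ℕ) : ℝ) / ((a.unpair.2 + 1 : ℕ) : ℝ) := by
  rw [cast_sub_add_sub, ratNumbering]
  push_cast
  rw [abs_div, abs_of_pos (a := (a.unpair.2 : ℝ) + 1) (by positivity)]

theorem cell_le (a : ℕ) : (cell a : ℝ) ≤ |(ratNumbering a : ℝ)| := by
  rw [abs_ratNumbering, cell]
  exact Nat.cast_div_le

theorem lt_cell_add_one (a : ℕ) : |(ratNumbering a : ℝ)| < cell a + 1 := by
  rw [abs_ratNumbering, cell, div_lt_iff₀ (by positivity)]
  exact_mod_cast (Nat.div_lt_iff_lt_mul (Nat.succ_pos _)).1 (Nat.lt_succ_self _)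

/-- The distance of the rational numbers with the codes `a` and `b` is at most `2^{-n}`. -/
def Close (a b n : ℕ) : Prop :=
  ((a.unpair.1.unpair.1 * (b.unpair.2 + 1) + b.unpair.1.unpair.2 * (a.unpair.2 + 1) -
      (a.unpair.1.unpair.2 * (b.unpair.2 + 1) + b.unpair.1.unpair.1 * (a.unpair.2 + 1))) +
    (a.unpair.1.unpair.2 * (b.unpair.2 + 1) + b.unpair.1.unpair.1 * (a.unpair.2 + 1) -
      (a.unpair.1.unpair.1 * (b.unpair.2 + 1) + b.unpair.1.unpair.2 * (a.unpair.2 + 1)))) * 2 ^ n ≤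
    (a.unpair.2 + 1) * (b.unpair.2 + 1)

theorem close_iff (a b n : ℕ) :
    Close a b n ↔ |(ratNumbering a : ℝ) - ratNumbering b| ≤ (1 / 2) ^ n := by
  rw [Close, ← Nat.cast_le (α := ℝ), Nat.cast_mul, cast_sub_add_sub]
  simp only [ratNumbering]
  push_cast
  generalize (a.unpair.1.unpair.1 : ℝ) = i
  generalize (a.unpair.1.unpair.2 : ℝ) = j
  generalize (b.unpair.1.unpair.1 : ℝ) = i'
  generalize (b.unpair.1.unpair.2 : ℝ) = j'
  have h1 : (0 : ℝ) < a.unpair.2 + 1 := by positivity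
  have h2 : (0 : ℝ) < b.unpair.2 + 1 := by positivity
  generalize (a.unpair.2 : ℝ) + 1 = k at *
  generalize (b.unpair.2 : ℝ) + 1 = k' at *
  have e : (i - j) / k - (i' - j') / k' = (i * k' + j' * k - (j * k' + i' * k)) / (k * k') := by
    field_simp
    ring
  rw [e, abs_div, abs_of_pos (mul_pos h1 h2), div_le_iff₀ (mul_pos h1 h2), one_div, inv_pow,
    inv_mul_eq_div, le_div_iff₀ (by positivity)]

/-! ### Limit computation of the table of cluster information. -/

/-- The minimal cell visited by the sequence of rationals coded by `c` between the times `m`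
and `m + t`. -/
noncomputable def minCellStage (c : Baire) (t m : ℕ) : ℕ := sInf {v | ∃ l ≤ t, cell (c (m + l)) ≤ v}

/-- The minimal cell visited by the sequence of rationals coded by `c` from time `m` on. -/
noncomputable def minCell (c : Baire) (m : ℕ) : ℕ := sInf {v | ∃ l, cell (c (m + l)) ≤ v}

/-- An approximation to `pick` that takes into account the first `t` entries only. -/
noncomputable def pickStage (c : Baire) (t j n : ℕ) : ℕ :=
  c (sInf {k | ∀ l ≤ t, k ≤ l → cell (c l) = j → Close (c l) (c k) (n + 3)})

/-- The code of an entry of `c` that is close to all later entries in cell `j`. -/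
noncomputable def pick (c : Baire) (j n : ℕ) : ℕ :=
  c (sInf {k | ∀ l, k ≤ l → cell (c l) = j → Close (c l) (c k) (n + 3)})

/-- The stages of the limit computation of `clusterTable`. -/
noncomputable def clusterTableStage (c : Baire) (t : ℕ) : Baire :=
  pairing (minCellStage c t) fun e => pickStage c t e.unpair.1 e.unpair.2

/-- The information on the cluster points of `c` that is obtained by a limit computation. -/
noncomputable def clusterTable (c : Baire) : Baire :=
  pairing (minCell c) fun e => pick c e.unpair.1 e.unpair.2

theorem eventually_minCellStage (c : Baire) (m : ℕ) :
    ∀ᶠ t in atTop, minCellStage c t m = minCell c m := by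
  have e : {v | ∃ l, cell (c (m + l)) ≤ v} = ⋃ t, {v | ∃ l ≤ t, cell (c (m + l)) ≤ v} := by
    ext v
    simp only [Set.mem_ofPred_eq, Set.mem_iUnion]
    exact ⟨fun ⟨l, hl⟩ => ⟨l, l, le_rfl, hl⟩, fun ⟨_, l, _, hl⟩ => ⟨l, hl⟩⟩
  unfold minCellStage minCell
  rw [e]
  refine eventually_sInf_eq_of_monotone ?_ ?_
  · rintro s t hst v ⟨l, hl, hv⟩
    exact ⟨l, hl.trans hst, hv⟩
  · rw [← e]
    exact ⟨_, 0, le_rfl⟩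

theorem CompPredOn.close {α : Type*} [Primcodable α] {D : Set Baire} {a b n : Baire → α → ℕ}
    (ha : CompOn D a) (hb : CompOn D b) (hn : CompOn D n) :
    CompPredOn D fun p x => Close (a p x) (b p x) (n p x) := by
  have a2 := ha.unpairSnd.add (CompOn.const 1)
  have b2 := hb.unpairSnd.add (CompOn.const 1)
  have e1 := (ha.unpairFst.unpairFst.mul b2).add (hb.unpairFst.unpairSnd.mul a2)
  have e2 := (ha.unpairFst.unpairSnd.mul b2).add (hb.unpairFst.unpairFst.mul a2)
  exact CompPredOn.le ((((e1.sub e2).add (e2.sub e1))).mul ((CompOn.const 2).pow hn)) (a2.mul b2)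

theorem CompOn.cell {α : Type*} [Primcodable α] {D : Set Baire} {a : Baire → α → ℕ}
    (ha : CompOn D a) : CompOn D fun p x => cell (a p x) := by
  have a1 := ha.unpairFst.unpairFst
  have a2 := ha.unpairFst.unpairSnd
  exact ((a1.sub a2).add (a2.sub a1)).div (ha.unpairSnd.add (CompOn.const 1))

theorem compOn_clusterTableStage :
    CompOn Set.univ fun c (z : ℕ × ℕ) => clusterTableStage c z.1 z.2 := by
  have hmin : CompOn Set.univ fun c (z : ℕ × ℕ) => minCellStage c z.1 z.2 := by
    refine CompOn.least (P := fun c (z : ℕ × ℕ) v => ∃ l ≤ z.1, Weihrauch.cell (c (z.2 + l)) ≤ v) ?_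
      fun c _ z => ⟨_, 0, Nat.zero_le _, le_rfl⟩
    refine CompPredOn.exists_le (n := fun _ (y : (ℕ × ℕ) × ℕ) => y.1.1) ?_
      (CompOn.fst (CompOn.fst CompOn.var))
    exact CompPredOn.le ((CompOn.add (CompOn.snd (CompOn.fst (CompOn.fst CompOn.var)))
      (CompOn.snd CompOn.var)).query.cell) (CompOn.snd (CompOn.fst CompOn.var))
  have hpick : CompOn Set.univ fun c (z : ℕ × ℕ × ℕ) => pickStage c z.1 z.2.1 z.2.2 := by
    refine CompOn.query (CompOn.least (P := fun c (z : ℕ × ℕ × ℕ) k => ∀ l ≤ z.1, k ≤ l →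
      Weihrauch.cell (c l) = z.2.1 → Close (c l) (c k) (z.2.2 + 3)) ?_
      -- Beyond stage `t` the condition is vacuous, so the search always stops.
      fun c _ z => ⟨z.1 + 1, fun l h1 h2 => by omega⟩)
    refine CompPredOn.forall_le (n := fun _ (y : (ℕ × ℕ × ℕ) × ℕ) => y.1.1) ?_
      (CompOn.fst (CompOn.fst CompOn.var))
    have hz := CompOn.fst (CompOn.fst (CompOn.var (α := ((ℕ × ℕ × ℕ) × ℕ) × ℕ) (D := Set.univ)))
    have hk := CompOn.snd (CompOn.fst (CompOn.var (α := ((ℕ × ℕ × ℕ) × ℕ) × ℕ) (D := Set.univ)))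
    have hl := CompOn.snd (CompOn.var (α := ((ℕ × ℕ × ℕ) × ℕ) × ℕ) (D := Set.univ))
    exact (CompPredOn.le hk hl).imp ((CompPredOn.eq hl.query.cell hz.snd.fst).imp
      (CompPredOn.close hl.query hk.query (hz.snd.snd.add (CompOn.const 3))))
  refine CompOn.pairing (S := fun c (z : ℕ × ℕ) m => minCellStage c z.1 m)
    (T := fun c (z : ℕ × ℕ) e => pickStage c z.1 e.unpair.1 e.unpair.2) (k := fun _ z => z.2)
    ?_ ?_ (CompOn.snd CompOn.var)
  · exact hmin.comp ((CompOn.fst (CompOn.fst CompOn.var)).pair (CompOn.snd CompOn.var))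
  · exact hpick.comp ((CompOn.fst (CompOn.fst CompOn.var)).pair
      ((CompOn.snd CompOn.var).unpairFst.pair (CompOn.snd CompOn.var).unpairSnd))

section Cluster

variable {c : Baire} {x : ℝ}

/-- Otherwise infinitely many entries of the cell stay at distance at least `ε` from `x` inside a
compact set, and they have a cluster point there. -/
theorem eventually_near_of_cell
    (hx : ∀ y, MapClusterPt y atTop (fun n => (ratNumbering (c n) : ℝ)) → y = x) (j : ℕ) {ε : ℝ}
    (hε : 0 < ε) : ∀ᶠ l in atTop, cell (c l) = j → |(ratNumbering (c l) : ℝ) - x| < ε := by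
  by_contra hcon
  have hK : IsCompact (Metric.closedBall (0 : ℝ) (j + 1) ∩ {y | ε ≤ |y - x|}) :=
    (isCompact_closedBall _ _).inter_right (isClosed_le continuous_const (by fun_prop))
  obtain ⟨y, hyK, hy⟩ := hK.exists_mapClusterPt_of_frequently (l := atTop)
    (f := fun n => (ratNumbering (c n) : ℝ)) (by
      refine (not_eventually.1 hcon).mono fun l hl => ?_
      push Not at hl
      refine ⟨?_, hl.2⟩
      rw [mem_closedBall_zero_iff, Real.norm_eq_abs, ← hl.1]
      exact (lt_cell_add_one _).le)
  have h := hyK.2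
  rw [hx y hy] at h
  simp only [Set.mem_ofPred_eq, sub_self, abs_zero] at h
  linarith

/-- The table must converge at every cell, also at those visited finitely often; there the condition
holds vacuously from some time on. -/
theorem exists_close_tail
    (hx : ∀ y, MapClusterPt y atTop (fun n => (ratNumbering (c n) : ℝ)) → y = x) (j n : ℕ) :
    ∃ k, ∀ l, k ≤ l → cell (c l) = j → Close (c l) (c k) n := by
  obtain ⟨k, hk⟩ := eventually_atTop.1 (eventually_near_of_cell hx j
    (show (0 : ℝ) < (1 / 2) ^ n / 2 by positivity))
  by_cases h : ∃ k' ≥ k, cell (c k') = j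
  · obtain ⟨k', hk', hj⟩ := h
    refine ⟨k', fun l hl hlj => (close_iff _ _ _).2 ?_⟩
    have h1 := abs_lt.1 (hk k' hk' hj)
    have h2 := abs_lt.1 (hk l (hk'.trans hl) hlj)
    rw [abs_le]
    constructor <;> linarith [h1.1, h1.2, h2.1, h2.2]
  · exact ⟨k, fun l hl hlj => absurd ⟨l, hl, hlj⟩ h⟩

theorem eventually_pickStage
    (hx : ∀ y, MapClusterPt y atTop (fun n => (ratNumbering (c n) : ℝ)) → y = x) (j n : ℕ) :
    ∀ᶠ t in atTop, pickStage c t j n = pick c j n := by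
  have e : {k | ∀ l, k ≤ l → cell (c l) = j → Close (c l) (c k) (n + 3)} =
      ⋂ t, {k | ∀ l ≤ t, k ≤ l → cell (c l) = j → Close (c l) (c k) (n + 3)} := by
    ext k
    simp only [Set.mem_ofPred_eq, Set.mem_iInter]
    exact ⟨fun h _ l _ => h l, fun h l => h l l le_rfl⟩
  unfold pickStage pick
  rw [e]
  refine (eventually_sInf_eq_of_antitone ?_ ?_).mono fun t ht => congrArg c ht
  · intro s t hst k hk l hl
    exact hk l (hl.trans hst)
  · rw [← e]
    exact exists_close_tail hx j (n + 3)

theorem tendsto_clusterTableStage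
    (hx : ∀ y, MapClusterPt y atTop (fun n => (ratNumbering (c n) : ℝ)) → y = x) :
    Tendsto (clusterTableStage c) atTop (𝓝 (clusterTable c)) := by
  rw [tendsto_baire_iff]
  intro k
  unfold clusterTableStage clusterTable pairing
  split_ifs with h
  · exact eventually_minCellStage c _
  · exact eventually_pickStage hx _ _

/-- Entries within 1 of `x` recur and bound the cells, so the nondecreasing `minCell c` stabilizes.
Its final value is attained after every time, hence infinitely often. -/
theorem exists_minCell_eq
    (hx : MapClusterPt x atTop (fun n => (ratNumbering (c n) : ℝ))) :
    ∃ j, (∀ᶠ m in atTop, minCell c m = j) ∧ ∃ᶠ m in atTop, cell (c m) = j := by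
  have hne : ∀ m, {v | ∃ l, cell (c (m + l)) ≤ v}.Nonempty := fun m => ⟨_, 0, le_rfl⟩
  have hfreq : ∃ᶠ l in atTop, (cell (c l) : ℝ) ≤ |x| + 1 := by
    refine (hx.frequently (Metric.ball_mem_nhds x one_pos)).mono fun l hl => ?_
    replace hl : |(ratNumbering (c l) : ℝ) - x| < 1 := by rw [← Real.dist_eq]; exact hl
    have h1 := cell_le (c l)
    have h2 := abs_sub_abs_le_abs_sub (ratNumbering (c l) : ℝ) x
    linarith
  let S : ℕ → Set ℕ := fun m => {v | ∃ l, cell (c (m + l)) ≤ v}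
  have hS : Antitone S := by
    rintro m n hmn v ⟨l, hl⟩
    exact ⟨n - m + l, by rwa [← Nat.add_assoc, Nat.add_sub_cancel' hmn]⟩
  have hI : (⋂ m, S m).Nonempty := by
    obtain ⟨B, hB⟩ := exists_nat_gt (|x| + 1)
    refine ⟨B, Set.mem_iInter.2 fun m => ?_⟩
    obtain ⟨l, hml, hl⟩ := frequently_atTop.1 hfreq m
    refine ⟨l - m, ?_⟩
    rw [Nat.add_sub_cancel' hml]
    exact_mod_cast (hl.trans hB.le)
  have hev := eventually_sInf_eq_of_antitone hS hI
  refine ⟨sInf (⋂ m, S m), hev, frequently_atTop.2 fun m => ?_⟩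
  obtain ⟨m', hm', hmm⟩ := (hev.and (eventually_ge_atTop m)).exists
  obtain ⟨l, hl⟩ := Set.mem_iInter.1 (Nat.sInf_mem hI) m'
  refine ⟨m' + l, by omega, le_antisymm hl ?_⟩
  rw [← hm']
  exact Nat.sInf_le ⟨l, le_rfl⟩

/-- Infinitely many visits to the cell are essential here: the picked entry is compared with later
entries of the cell, which tend to `x`. -/
theorem abs_pick_sub_le
    (hx : ∀ y, MapClusterPt y atTop (fun n => (ratNumbering (c n) : ℝ)) → y = x) {j : ℕ}
    (hj : ∃ᶠ m in atTop, cell (c m) = j) (n : ℕ) :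
    |(ratNumbering (pick c j n) : ℝ) - x| ≤ (1 / 2) ^ (n + 3) := by
  have hk : sInf {k | ∀ l, k ≤ l → cell (c l) = j → Close (c l) (c k) (n + 3)} ∈
      {k | ∀ l, k ≤ l → cell (c l) = j → Close (c l) (c k) (n + 3)} :=
    Nat.sInf_mem (exists_close_tail hx j (n + 3))
  refine le_of_forall_pos_le_add fun ε hε => ?_
  obtain ⟨l, hlj, hl, hkl⟩ := (hj.and_eventually ((eventually_near_of_cell hx j hε).and
    (eventually_ge_atTop (sInf {k | ∀ l, k ≤ l → cell (c l) = j → Close (c l) (c k) (n + 3)})))).exists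
  have h1 := abs_le.1 ((close_iff _ _ _).1 (hk l hkl hlj))
  have h2 := abs_lt.1 (hl hlj)
  unfold pick
  rw [abs_le]
  constructor <;> linarith [h1.1, h1.2, h2.1, h2.2]

end Cluster

/-! ### Names of reals and the passage to a rational sequence. -/

theorem isName_real_of_abs_sub_le {p : Baire} {x : ℝ}
    (h : ∀ n, |(ratNumbering (p n) : ℝ) - x| ≤ (1 / 2) ^ (n + 2)) :
    RepresentedSpace.IsName p x := by
  have hpow : ∀ n, ((1 : ℝ) / 2) ^ (n + 2) = (1 / 2) ^ n / 4 := fun n => by rw [pow_add]; ring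
  refine ⟨fun n k hnk => ?_, ?_⟩
  · have h1 := abs_le.1 (h n)
    have h2 := abs_le.1 (h k)
    have h3 : ((1 : ℝ) / 2) ^ k ≤ (1 / 2) ^ n :=
      pow_le_pow_of_le_one (by norm_num) (by norm_num) hnk.le
    have h4 : (0 : ℝ) < (1 / 2) ^ n := by positivity
    rw [hpow] at h1 h2
    rw [abs_lt]
    constructor <;> linarith [h1.1, h1.2, h2.1, h2.2]
  · rw [tendsto_iff_dist_tendsto_zero]
    refine squeeze_zero (fun _ => dist_nonneg) (fun n => ?_)
      ((tendsto_pow_atTop_nhds_zero_of_lt_one (r := (1 / 2 : ℝ))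
        (by norm_num) (by norm_num)).comp (tendsto_add_atTop_nat 2))
    rw [Real.dist_eq]
    exact h n

theorem abs_sub_le_of_isName_real {p : Baire} {x : ℝ} (h : RepresentedSpace.IsName p x) (n : ℕ) :
    |(ratNumbering (p n) : ℝ) - x| ≤ (1 / 2) ^ n := by
  refine le_of_tendsto ((tendsto_const_nhds.sub h.2).abs) ?_
  filter_upwards [eventually_gt_atTop n] with k hk using (h.1 n k hk).le

/-- The diagonal `n ↦ r_n(n)` of `r = ⟨r_0, r_1, …⟩`. -/
def diagonal (r : Baire) : Baire := fun n => row r n n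

/-- The diagonal entry is within `2^{-n}` of `z n`, and sequences whose distance tends to 0 have the
same cluster points. -/
theorem mapClusterPt_diagonal_iff {r : Baire} {z : ℕ → ℝ} (hr : RepresentedSpace.IsName r z)
    (y : ℝ) : MapClusterPt y atTop (fun n => (ratNumbering (diagonal r n) : ℝ)) ↔
      MapClusterPt y atTop z := by
  have h0 : Tendsto (fun n => dist (ratNumbering (diagonal r n) : ℝ) (z n)) atTop (𝓝 0) := by
    refine squeeze_zero (fun _ => dist_nonneg) (fun n => ?_)
      (tendsto_pow_atTop_nhds_zero_of_lt_one (r := (1 / 2 : ℝ)) (by norm_num) (by norm_num))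
    rw [Real.dist_eq]
    exact abs_sub_le_of_isName_real (hr n) n
  have key : ∀ a b : ℕ → ℝ, Tendsto (fun n => dist (a n) (b n)) atTop (𝓝 0) →
      MapClusterPt y atTop a → MapClusterPt y atTop b := by
    intro a b hab ha
    rw [mapClusterPt_iff_frequently] at ha ⊢
    intro s hs
    obtain ⟨ε, hε, hs⟩ := Metric.mem_nhds_iff.1 hs
    refine ((ha _ (Metric.ball_mem_nhds y (half_pos hε))).and_eventually
      (hab.eventually (gt_mem_nhds (half_pos hε)))).mono fun n hn => hs ?_
    rw [Metric.mem_ball] at *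
    have := dist_triangle_left (b n) y (a n)
    linarith [hn.1, hn.2]
  exact ⟨key _ _ h0, key _ _ (by simpa only [dist_comm] using h0)⟩

theorem mem_UCL_iff {z : ℕ → ℝ} {x : ℝ} :
    x ∈ UCL ℝ z ↔ ∀ y, MapClusterPt y atTop z ↔ y = x := by
  change CL ℝ z = {x} ↔ _
  rw [Set.ext_iff]
  rfl

instance {X : Type u} [RepresentedSpace X] : RepresentedSpace (ULift.{w} X) where
  IsName p x := RepresentedSpace.IsName p x.down
  eq_of_isName h₁ h₂ := ULift.ext _ _ (RepresentedSpace.eq_of_isName h₁ h₂)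
  exists_isName x := RepresentedSpace.exists_isName x.down

/-! ### Everything reducible to `UCL ℝ` factors as required. -/

theorem isLimitFinMindChangeComputable_of_reducible {X : Type u} {Y : Type v} [RepresentedSpace X]
    [RepresentedSpace Y] {f : MultiFun X Y} (hf : WeihrauchReducible f (UCL ℝ)) :
    IsLimitFinMindChangeComputable.{u, v, w} f := by
  obtain ⟨K, H, hK, hH, hred⟩ := weihrauchReducible_iff.1 hf
  let tbl : Baire → Baire := fun p => clusterTable (diagonal (total H p))
  -- The intermediate point keeps the name `p`: it determines `x`, which makes `g ∘ h` equal to `f`,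
  -- and `K` needs it as well.
  let h : MultiFun X (ULift.{w} Baire) := fun x => {z | x ∈ f.dom ∧
    ∃ p, RepresentedSpace.IsName p x ∧ z.down = pairing p (tbl p)}
  let g : MultiFun (ULift.{w} Baire) Y := fun z => {y | ∃ p x, RepresentedSpace.IsName p x ∧
    z.down = pairing p (tbl p) ∧ y ∈ f x}
  refine ⟨ULift.{w} Baire, inferInstance, g, h, ?_, ?_, ?_⟩
  · refine weihrauchReducible_iff.2 ⟨fun o => ⟨(K (pairing (left (left o)) (right o))).Dom,
      fun _ => total K (pairing (left (left o)) (right o))⟩,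
      fun o => ⟨o ∈ Set.univ, fun _ k => right (right o) (Nat.pair (left (right o) k.unpair.1) k.unpair.2)⟩,
      ?_, ?_, ?_⟩
    · have h1 : CompOn Set.univ fun o => pairing (left (left o)) (right o) := by
        refine CompOn.pairing_baire ?_ (CompOn.right CompOn.var)
        exact ((CompOn.const 2).mul ((CompOn.const 2).mul CompOn.var)).query
      exact (CompOn.comp_baire (D := {o | (K (pairing (left (left o)) (right o))).Dom})
        hK.compOn_total (h1.mono (Set.subset_univ _)) fun o ho => ho).isComputable
    · exact CompOn.comp_baire (D := Set.univ) (E := Set.univ)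
        (T := fun o k => right o (Nat.pair (left o k.unpair.1) k.unpair.2))
        (CompOn.right ((CompOn.left CompOn.var.unpairFst).natPair CompOn.var.unpairSnd))
        (CompOn.right CompOn.var) (fun _ _ => Set.mem_univ _) |>.isComputable
    · rintro o z hz ⟨y, p, x, hp, hzp, hy⟩
      obtain rfl : o = pairing p (tbl p) := (show o = z.down from hz).trans hzp
      obtain ⟨r, hr, a, ⟨b, hb⟩, hra, hK'⟩ := hred p x hp ⟨y, hy⟩
      have hb' := mem_UCL_iff.1 hb
      have hx : ∀ y, MapClusterPt y atTop (fun n => (ratNumbering (diagonal r n) : ℝ)) ↔ y = b :=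
        fun y => (mapClusterPt_diagonal_iff hra y).trans (hb' y)
      have htbl : tbl p = clusterTable (diagonal r) := by
        simp only [tbl, total_eq hr]
      obtain ⟨j, hj, hj'⟩ := exists_minCell_eq ((hx b).2 rfl)
      let s : Baire := fun n => pick (diagonal r) j n
      have hs : RepresentedSpace.IsName s b := isName_real_of_abs_sub_le fun n =>
        (abs_pick_sub_le (fun y => (hx y).1) hj' n).trans
          (pow_le_pow_of_le_one (by norm_num) (by norm_num) (by omega))
      -- Row `m` lists the picks for the cell `minCell m`; once `minCell` has reached `j`, all rows
      -- equal `s`.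
      have hlim : Tendsto (row fun k => right (right (pairing p (tbl p)))
          (Nat.pair (left (right (pairing p (tbl p))) k.unpair.1) k.unpair.2)) atTop (@nhds Baire ⊥ s) := by
        refine tendsto_discrete_iff.2 (hj.mono fun m hm => ?_)
        funext n
        simp [row, htbl, clusterTable, hm, s]
      refine ⟨_, ⟨Set.mem_univ _, rfl⟩, _, ⟨s, hlim⟩, rfl, ?_⟩
      rintro s' t ht (rfl : s' = t)
      obtain ⟨m, hm, hm'⟩ :=
        ((tendsto_discrete_iff.1 ht).and (tendsto_discrete_iff.1 hlim)).exists
      obtain rfl : s' = s := hm.symm.trans hm'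
      obtain ⟨q, hq, y', hy', hqy⟩ := hK' _ b hb hs
      have hd : (K (pairing (left (left (pairing (pairing p (tbl p)) s)))
          (right (pairing (pairing p (tbl p)) s)))).Dom := by
        simpa using Part.dom_iff_mem.2 ⟨q, hq⟩
      refine ⟨_, ⟨hd, rfl⟩, y', ⟨p, x, hp, hzp, hy'⟩, ?_⟩
      simpa [total_eq hq] using hqy
  · refine weihrauchReducible_iff.2 ⟨fun o => ⟨o ∈ Set.univ, fun _ => o⟩,
      fun p => ⟨(H p).Dom, fun _ k =>
        clusterTableStage (diagonal (total H p)) k.unpair.1 k.unpair.2⟩, ?_, ?_, ?_⟩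
    · exact CompOn.isComputable CompOn.oracle
    · refine CompOn.isComputable (D := {p | (H p).Dom}) ?_
      refine CompOn.comp_baire (E := Set.univ) (T := fun c k =>
        clusterTableStage c k.unpair.1 k.unpair.2) (S := fun p => diagonal (total H p)) ?_ ?_
        fun _ _ => Set.mem_univ _
      · exact compOn_clusterTableStage.comp (CompOn.var.unpairFst.pair CompOn.var.unpairSnd)
      · exact CompOn.comp (T := total H) hH.compOn_total (CompOn.var.natPair CompOn.var)
    · rintro p x hp ⟨_, hx, -⟩
      obtain ⟨r, hr, a, ⟨b, hb⟩, hra, -⟩ := hred p x hp hx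
      have hb' := mem_UCL_iff.1 hb
      have hx' : ∀ y, MapClusterPt y atTop (fun n => (ratNumbering (diagonal r n) : ℝ)) → y = b :=
        fun y hy => (hb' y).1 ((mapClusterPt_diagonal_iff hra y).1 hy)
      have hrow : row (fun k => clusterTableStage (diagonal (total H p)) k.unpair.1 k.unpair.2) =
          clusterTableStage (diagonal r) := by
        funext t k
        simp [row, total_eq hr]
      have hlim : Tendsto (row (fun k =>
          clusterTableStage (diagonal (total H p)) k.unpair.1 k.unpair.2)) atTop (𝓝 (tbl p)) := by
        rw [hrow]
        simp only [tbl, total_eq hr]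
        exact tendsto_clusterTableStage hx'
      have hd : (H p).Dom := Part.dom_iff_mem.2 ⟨r, hr⟩
      refine ⟨_, ⟨hd, rfl⟩, _, ⟨tbl p, hlim⟩, rfl, ?_⟩
      rintro s t ht (rfl : s = t)
      obtain rfl := tendsto_nhds_unique ht hlim
      exact ⟨_, ⟨Set.mem_univ _, rfl⟩, ULift.up (pairing p (tbl p)), ⟨hx, p, hp, rfl⟩, rfl⟩
  · funext x
    ext y
    constructor
    · intro hy
      obtain ⟨p, hp⟩ := RepresentedSpace.exists_isName x
      refine ⟨?_, ULift.up (pairing p (tbl p)), ⟨⟨y, hy⟩, p, hp, rfl⟩, p, x, hp, rfl, hy⟩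
      rintro z ⟨-, p', hp', hz⟩
      exact ⟨y, p', x, hp', hz, hy⟩
    · rintro ⟨-, z, ⟨-, p, hp, hz⟩, p', x', hp', hz', hy⟩
      obtain ⟨rfl, -⟩ := pairing_injective (hz.symm.trans hz')
      rwa [RepresentedSpace.eq_of_isName hp hp']

/-! ### True stages of a convergent sequence in Baire space. -/

section TrueStages

/-- The length up to which the `n`-th entry of `u` agrees with its successor, capped at `n`. -/
noncomputable def agreement (u : ℕ → Baire) (n : ℕ) : ℕ := sInf {k | n ≤ k ∨ u n k ≠ u (n + 1) k}

/-- The last change of `m ↦ γ (u_n(0), …, u_n(m-1))` up to the agreement length of `u_n`. -/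
noncomputable def lastChange (γ : List ℕ → ℕ) (u : ℕ → Baire) (n : ℕ) : ℕ :=
  sInf {c | ∀ m ≤ agreement u n, c ≤ m → γ (initSeg (u n) m) = γ (initSeg (u n) c)}

variable {u : ℕ → Baire} {w : Baire}

theorem eq_of_lt_agreement {n k : ℕ} (h : k < agreement u n) : u n k = u (n + 1) k := by
  have := Nat.notMem_of_lt_sInf h
  simp only [Set.mem_ofPred_eq, not_or, not_not] at this
  exact this.2

theorem eventually_forall_lt (hu : Tendsto u atTop (𝓝 w)) (M : ℕ) :
    ∀ᶠ n in atTop, ∀ k < M, u n k = w k :=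
  (Set.finite_Iio M).eventually_all.2 fun k _ => tendsto_baire_iff.1 hu k

theorem eventually_le_agreement (hu : Tendsto u atTop (𝓝 w)) (M : ℕ) :
    ∀ᶠ n in atTop, M ≤ agreement u n := by
  filter_upwards [eventually_forall_lt hu M,
    (tendsto_add_atTop_nat 1).eventually (eventually_forall_lt hu M), eventually_ge_atTop M]
    with n h1 h2 h3
  refine le_csInf ⟨n, Or.inl le_rfl⟩ ?_
  rintro k (hk | hk)
  · exact h3.trans hk
  · by_contra hlt
    exact hk ((h1 k (not_le.1 hlt)).trans (h2 k (not_le.1 hlt)).symm)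

/-- Take `n ≥ N` with least agreement length. All later stages agree with their successors at least
that far, so this part of `u n` never changes again. -/
theorem frequently_eq_of_lt_agreement (hu : Tendsto u atTop (𝓝 w)) :
    ∃ᶠ n in atTop, ∀ k < agreement u n, u n k = w k := by
  refine frequently_atTop.2 fun N => ?_
  have hne : (agreement u '' Set.Ici N).Nonempty := ⟨_, N, Set.mem_Ici.2 le_rfl, rfl⟩
  obtain ⟨n, hn, he⟩ := Nat.sInf_mem hne
  refine ⟨n, hn, fun k hk => ?_⟩
  have hmin : ∀ n' ≥ n, k < agreement u n' := fun n' hn' => by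
    refine hk.trans_le ?_
    rw [he]
    exact Nat.sInf_le ⟨n', le_trans (show N ≤ n from hn) hn', rfl⟩
  have hconst : ∀ n' ≥ n, u n k = u n' k := fun n' hn' => by
    induction n', hn' using Nat.le_induction with
    | base => rfl
    | succ n' hn' ih => exact ih.trans (eq_of_lt_agreement (hmin n' hn'))
  obtain ⟨n', h1, h2⟩ := ((tendsto_baire_iff.1 hu k).and (eventually_ge_atTop n)).exists
  exact (hconst n' h2).trans h1

variable {γ : List ℕ → ℕ} {c : ℕ}

/-- Minimality of `c` is witnessed by finitely many changes of `γ`, so it can be seen on a finite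
prefix of `w`. -/
theorem exists_change_bound
    (hmin : ∀ c' < c, ∃ m ≥ c', γ (initSeg w m) ≠ γ (initSeg w c')) :
    ∃ M, c ≤ M ∧ ∀ v : Baire, (∀ k < M, v k = w k) → ∀ c' < c, ∃ m, c' ≤ m ∧ m ≤ M ∧
      γ (initSeg v m) ≠ γ (initSeg v c') := by
  choose! m hm hm' using hmin
  let M := max c ((Finset.range c).sup m)
  have hM : ∀ c' < c, m c' ≤ M := fun c' hc' =>
    (Finset.le_sup (f := m) (Finset.mem_range.2 hc')).trans (le_max_right _ _)
  refine ⟨M, le_max_left _ _, fun v hv c' hc' => ⟨m c', hm c' hc', hM c' hc', ?_⟩⟩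
  rw [initSeg_congr fun k hk => hv k (hk.trans_le (hM c' hc')),
    initSeg_congr fun k hk => hv k (hk.trans (hc'.trans_le (le_max_left _ _)))]
  exact hm' c' hc'

theorem lastChange_spec (γ : List ℕ → ℕ) (u : ℕ → Baire) (n : ℕ) :
    ∀ m ≤ agreement u n, lastChange γ u n ≤ m →
      γ (initSeg (u n) m) = γ (initSeg (u n) (lastChange γ u n)) := by
  have hne : {c | ∀ m ≤ agreement u n, c ≤ m →
      γ (initSeg (u n) m) = γ (initSeg (u n) c)}.Nonempty :=
    ⟨agreement u n, fun m h1 h2 => by rw [le_antisymm h1 h2]⟩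
  exact Nat.sInf_mem hne

theorem frequently_lastChange_eq (hu : Tendsto u atTop (𝓝 w))
    (hc : ∀ m ≥ c, γ (initSeg w m) = γ (initSeg w c))
    (hmin : ∀ c' < c, ∃ m ≥ c', γ (initSeg w m) ≠ γ (initSeg w c')) :
    ∃ᶠ n in atTop, lastChange γ u n = c := by
  obtain ⟨M, hcM, hM⟩ := exists_change_bound hmin
  refine ((frequently_eq_of_lt_agreement hu).and_eventually
    (eventually_le_agreement hu M)).mono fun n hn => le_antisymm (Nat.sInf_le fun m h1 h2 => ?_) ?_
  · rw [initSeg_congr fun k hk => hn.1 k (hk.trans_le h1),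
      initSeg_congr fun k hk => hn.1 k (hk.trans_le (hcM.trans hn.2))]
    exact hc m h2
  · by_contra hlt
    obtain ⟨m, h1, h2, h3⟩ := hM (u n) (fun k hk => hn.1 k (hk.trans_le hn.2)) _ (not_le.1 hlt)
    exact h3 (lastChange_spec γ u n m (h2.trans hn.2) h1)

/-- For large `n`, `u n` is correct up to `max M B`. An estimate at most `B` means that `γ` is
constant from there to the agreement length, even on the possibly wrong part beyond; its value is
then that at `max M B`, which is correct, and the estimate must be `c`. -/
theorem eventually_lastChange (hu : Tendsto u atTop (𝓝 w))
    (hc : ∀ m ≥ c, γ (initSeg w m) = γ (initSeg w c))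
    (hmin : ∀ c' < c, ∃ m ≥ c', γ (initSeg w m) ≠ γ (initSeg w c')) (B : ℕ) :
    ∀ᶠ n in atTop, lastChange γ u n = c ∨ B < lastChange γ u n := by
  obtain ⟨M, hcM, hM⟩ := exists_change_bound hmin
  filter_upwards [eventually_forall_lt hu (max M B), eventually_le_agreement hu (max M B)]
    with n h1 h2
  have hMn : M ≤ agreement u n := (le_max_left _ _).trans h2
  have hseg : ∀ m ≤ max M B, initSeg (u n) m = initSeg w m := fun m hm =>
    initSeg_congr fun k hk => h1 k (hk.trans_le hm)
  refine or_iff_not_imp_right.2 fun hB => le_antisymm (Nat.sInf_le fun m h3 h4 => ?_) ?_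
  · have hcM' : c ≤ max M B := hcM.trans (le_max_left _ _)
    have hle : lastChange γ u n ≤ max M B := (not_lt.1 hB).trans (le_max_right _ _)
    rcases le_or_gt m (max M B) with hm | hm
    · rw [hseg m hm, hseg c hcM', hc m h4]
    · rw [lastChange_spec γ u n m h3 (hle.trans hm.le),
        ← lastChange_spec γ u n (max M B) h2 hle, hseg _ le_rfl, hseg c hcM', hc _ hcM']
  · by_contra hlt
    obtain ⟨m, h3, h4, h5⟩ := hM (u n) (fun k hk => h1 k (hk.trans_le (le_max_left _ _))) _
      (not_le.1 hlt)
    exact h5 (lastChange_spec γ u n m (h4.trans hMn) h3)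

end TrueStages

/-! ### Coding a number and a sequence into one real. -/

section Quaternary

/-- The numerator of the rational with integer part `c` and the quaternary digits
`b 0, …, b (n-1)`. -/
def quaternaryNum (c : ℕ) (b : ℕ → ℕ) (n : ℕ) : ℕ :=
  Nat.rec (motive := fun _ => ℕ) c (fun k y => 4 * y + b k) n

/-- The real number with integer part `c` and the quaternary digits `b`. -/
noncomputable def quaternary (c : ℕ) (b : ℕ → ℕ) : ℝ := ⨆ n, (quaternaryNum c b n : ℝ) / 4 ^ n

theorem quaternaryNum_succ (c : ℕ) (b : ℕ → ℕ) (n : ℕ) :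
    quaternaryNum c b (n + 1) = 4 * quaternaryNum c b n + b n := rfl

theorem quaternaryNum_congr {c : ℕ} {b b' : ℕ → ℕ} {n : ℕ} (h : ∀ k < n, b k = b' k) :
    quaternaryNum c b n = quaternaryNum c b' n := by
  induction n with
  | zero => rfl
  | succ n ih =>
    rw [quaternaryNum_succ, quaternaryNum_succ, ih fun k hk => h k (Nat.lt_succ_of_lt hk),
      h n n.lt_succ_self]

variable {c : ℕ} {b : ℕ → ℕ}

theorem le_quaternaryNum_div {J n : ℕ} (h : J ≤ n) :
    (quaternaryNum c b J : ℝ) / 4 ^ J ≤ (quaternaryNum c b n : ℝ) / 4 ^ n := by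
  induction n, h using Nat.le_induction with
  | base => rfl
  | succ n _ ih =>
    refine ih.trans ?_
    rw [div_le_div_iff₀ (by positivity) (by positivity), quaternaryNum_succ, pow_succ]
    push_cast
    nlinarith [show (0 : ℝ) ≤ b n * 4 ^ n by positivity]

/-- The constant `1 / 3` is the sum of `4^{-k}` over `k ≥ 1`, a bound for the tail of 0-1 digits;
with it added, the quotients are nonincreasing in `n`. -/
theorem quaternaryNum_div_le (hb : ∀ k, b k ≤ 1) {J n : ℕ} (h : J ≤ n) :
    (quaternaryNum c b n : ℝ) / 4 ^ n ≤ (quaternaryNum c b J + 1 / 3) / 4 ^ J := by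
  suffices hs : ((quaternaryNum c b n : ℝ) + 1 / 3) / 4 ^ n ≤ (quaternaryNum c b J + 1 / 3) / 4 ^ J by
    refine le_trans ?_ hs
    gcongr
    linarith
  induction n, h using Nat.le_induction with
  | base => rfl
  | succ n _ ih =>
    refine le_trans ?_ ih
    rw [div_le_div_iff₀ (by positivity) (by positivity), quaternaryNum_succ, pow_succ]
    have : (b n : ℝ) ≤ 1 := by exact_mod_cast hb n
    push_cast
    nlinarith [show (0 : ℝ) ≤ (1 - b n) * 4 ^ n from mul_nonneg (by linarith) (by positivity)]

theorem bddAbove_quaternary (hb : ∀ k, b k ≤ 1) :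
    BddAbove (Set.range fun n => (quaternaryNum c b n : ℝ) / 4 ^ n) :=
  ⟨_, by rintro _ ⟨n, rfl⟩; exact quaternaryNum_div_le hb (Nat.zero_le n)⟩

theorem le_quaternary (hb : ∀ k, b k ≤ 1) (J : ℕ) :
    (quaternaryNum c b J : ℝ) / 4 ^ J ≤ quaternary c b :=
  le_ciSup (bddAbove_quaternary hb) J

theorem quaternary_le (hb : ∀ k, b k ≤ 1) (J : ℕ) :
    quaternary c b ≤ (quaternaryNum c b J + 1 / 3) / 4 ^ J :=
  ciSup_le fun n => (le_quaternaryNum_div (le_max_left n J)).trans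
    (quaternaryNum_div_le hb (le_max_right n J))

/-- The graph of `a` as a sequence of zeros and ones. -/
def graphBit (a : Baire) (k : ℕ) : ℕ := if a k.unpair.1 = k.unpair.2 then 1 else 0

theorem graphBit_le (a : Baire) (k : ℕ) : graphBit a k ≤ 1 := by
  unfold graphBit
  split_ifs <;> omega

/-- Stages with `κ n = c` recur and converge digitwise to the coded real. At the others the value is
at least `κ n`, which exceeds any bound. -/
theorem mapClusterPt_quaternary_iff {a : ℕ → Baire} {a' : Baire} (ha : Tendsto a atTop (𝓝 a'))
    {κ : ℕ → ℕ} (h1 : ∃ᶠ n in atTop, κ n = c) (h2 : ∀ B, ∀ᶠ n in atTop, κ n = c ∨ B < κ n)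
    (y : ℝ) : MapClusterPt y atTop
      (fun n => (quaternaryNum (κ n) (graphBit (a n)) n : ℝ) / 4 ^ n) ↔
      y = quaternary c (graphBit a') := by
  have hnear : ∀ ε > 0, ∀ᶠ n in atTop, κ n = c →
      |(quaternaryNum (κ n) (graphBit (a n)) n : ℝ) / 4 ^ n - quaternary c (graphBit a')| < ε := by
    intro ε hε
    obtain ⟨J, hJ⟩ := exists_pow_lt_of_lt_one hε (show (1 / 4 : ℝ) < 1 by norm_num)
    have hbits : ∀ᶠ n in atTop, ∀ k < J, graphBit (a n) k = graphBit a' k := by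
      refine (Set.finite_Iio J).eventually_all.2 fun k _ => ?_
      filter_upwards [tendsto_baire_iff.1 ha k.unpair.1] with n hn
      rw [graphBit, graphBit, hn]
    filter_upwards [hbits, eventually_ge_atTop J] with n hn hJn hκ
    rw [hκ]
    have e := quaternaryNum_congr (c := c) hn
    have b1 := le_quaternaryNum_div (c := c) (b := graphBit (a n)) hJn
    have b2 := quaternaryNum_div_le (c := c) (graphBit_le (a n)) hJn
    have b3 := le_quaternary (c := c) (graphBit_le a') J
    have b4 := quaternary_le (c := c) (graphBit_le a') J
    rw [e] at b1 b2
    have e' : ((quaternaryNum c (graphBit a') J : ℝ) + 1 / 3) / 4 ^ J =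
      quaternaryNum c (graphBit a') J / 4 ^ J + 1 / 3 * (1 / 4) ^ J := by
      rw [add_div, one_div_pow]; ring
    rw [e'] at b2 b4
    have : (0 : ℝ) < (1 / 4) ^ J := by positivity
    rw [abs_lt]
    constructor <;> linarith
  constructor
  · intro hy
    by_contra hne
    have hd : 0 < |y - quaternary c (graphBit a')| := abs_pos.2 (sub_ne_zero.2 hne)
    obtain ⟨B, hB⟩ := exists_nat_gt (y + 1)
    have hf := (hy.frequently (Metric.ball_mem_nhds y (lt_min one_pos (half_pos hd)))).and_eventually
      ((h2 B).and (hnear _ (half_pos hd)))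
    obtain ⟨n, hn1, hn2, hn3⟩ := hf.exists
    rw [Real.dist_eq, lt_min_iff] at hn1
    rcases hn2 with hn2 | hn2
    · have e1 := hn3 hn2
      have := abs_sub_le y ((quaternaryNum (κ n) (graphBit (a n)) n : ℝ) / 4 ^ n)
        (quaternary c (graphBit a'))
      rw [abs_sub_comm y (_ / _)] at this
      linarith [hn1.2]
    · have e1 := le_quaternaryNum_div (c := κ n) (b := graphBit (a n)) (Nat.zero_le n)
      have e2 : ((quaternaryNum (κ n) (graphBit (a n)) 0 : ℕ) : ℝ) / 4 ^ 0 = κ n := by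
        rw [pow_zero, div_one]; rfl
      rw [e2] at e1
      have e3 : (B : ℝ) < κ n := by exact_mod_cast hn2
      linarith [(abs_lt.1 hn1.1).2]
  · rintro rfl
    rw [mapClusterPt_iff_frequently]
    intro s hs
    obtain ⟨ε, hε, hs⟩ := Metric.mem_nhds_iff.1 hs
    refine (h1.and_eventually (hnear ε hε)).mono fun n hn => hs ?_
    rw [Metric.mem_ball, Real.dist_eq]
    exact hn.2 hn.1

/-- The integer part of `4^J x`, computed from a name of `x` under the assumption that the
fractional part is small. -/
def decodeNum (s : Baire) (J : ℕ) : ℕ :=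
  (3 * ((s (2 * J + 2)).unpair.1.unpair.1 - (s (2 * J + 2)).unpair.1.unpair.2) * 4 ^ J +
    ((s (2 * J + 2)).unpair.2 + 1)) / (3 * ((s (2 * J + 2)).unpair.2 + 1))

/-- With `N = quaternaryNum c b J`, `4^J x` lies in `[N, N + 1/3]`, and the entry used has scaled
error at most `1/4`. Adding `1/3` to the scaled entry puts it between `N + 1/12` and `N + 11/12`, so
rounding down is safe. -/
theorem decodeNum_eq {s : Baire} (hb : ∀ k, b k ≤ 1)
    (hs : RepresentedSpace.IsName s (quaternary c b)) (J : ℕ) :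
    decodeNum s J = quaternaryNum c b J := by
  have h1 := abs_le.1 (abs_sub_le_of_isName_real hs (2 * J + 2))
  have h2 := le_quaternary (c := c) hb J
  have h3 := quaternary_le (c := c) hb J
  have e : ((1 : ℝ) / 2) ^ (2 * J + 2) = 1 / 4 / 4 ^ J := by
    rw [pow_add, pow_mul]
    norm_num [div_eq_mul_inv, mul_comm]
    rw [one_div, inv_pow]
  have hpos : (0 : ℝ) < 4 ^ J := by positivity
  rw [e] at h1
  rw [div_le_iff₀ hpos] at h2
  rw [le_div_iff₀ hpos] at h3
  have h4 : (ratNumbering (s (2 * J + 2)) : ℝ) * 4 ^ J ≤ quaternary c b * 4 ^ J + 1 / 4 := by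
    have := mul_le_mul_of_nonneg_right h1.2 hpos.le
    rw [div_mul_cancel₀ _ hpos.ne'] at this
    linarith
  have h5 : quaternary c b * 4 ^ J - 1 / 4 ≤ (ratNumbering (s (2 * J + 2)) : ℝ) * 4 ^ J := by
    have := mul_le_mul_of_nonneg_right h1.1 hpos.le
    rw [neg_mul, div_mul_cancel₀ _ hpos.ne'] at this
    linarith
  unfold decodeNum
  simp only [ratNumbering] at h4 h5
  push_cast at h4 h5
  generalize (s (2 * J + 2)).unpair.1.unpair.1 = i at *
  generalize (s (2 * J + 2)).unpair.1.unpair.2 = j at *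
  generalize (s (2 * J + 2)).unpair.2 = k at *
  generalize quaternaryNum c b J = N at *
  have hk : (0 : ℝ) < k + 1 := by positivity
  rw [div_mul_eq_mul_div, div_le_iff₀ hk] at h4
  rw [div_mul_eq_mul_div, le_div_iff₀ hk] at h5
  have hup : ((i : ℝ) - j) * 4 ^ J ≤ (N + 7 / 12) * (k + 1) := 
    h4.trans (mul_le_mul_of_nonneg_right (by linarith) hk.le)
  have hlo : ((N : ℝ) - 1 / 4) * (k + 1) ≤ ((i : ℝ) - j) * 4 ^ J :=
    le_trans (mul_le_mul_of_nonneg_right (by linarith) hk.le) h5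
  rcases le_total j i with hij | hij
  · refine Nat.div_eq_of_lt_le ?_ ?_
    · rw [← Nat.cast_le (α := ℝ)]
      push_cast [Nat.cast_sub hij]
      nlinarith
    · rw [← Nat.cast_lt (α := ℝ)]
      push_cast [Nat.cast_sub hij]
      nlinarith
  -- Here the natural subtraction truncates to 0; the rational is not positive, so `N = 0`, and the
  -- decoded value is the integer part of `1/3`.
  · have hN : N = 0 := by
      have : (i : ℝ) - j ≤ 0 := sub_nonpos.2 (by exact_mod_cast hij)
      have h6 : ((N : ℝ) - 1 / 4) * (k + 1) ≤ 0 :=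
        hlo.trans (mul_nonpos_of_nonpos_of_nonneg this hpos.le)
      have h7 : (N : ℝ) - 1 / 4 ≤ 0 := by
        by_contra h
        exact absurd h6 (not_le.2 (mul_pos (not_le.1 h) hk))
      have h8 : (N : ℝ) < 1 := by linarith
      exact Nat.lt_one_iff.1 (by exact_mod_cast h8)
    rw [hN, Nat.sub_eq_zero_of_le hij]
    exact Nat.div_eq_of_lt (by omega)

theorem decodeNum_mod {s a : Baire}
    (hs : RepresentedSpace.IsName s (quaternary c (graphBit a))) (k v : ℕ) :
    decodeNum s (Nat.pair k v + 1) % 4 = 1 ↔ a k = v := by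
  rw [decodeNum_eq (graphBit_le a) hs, quaternaryNum_succ, Nat.mul_add_mod, graphBit,
    Nat.unpair_pair]
  dsimp only
  split_ifs with h <;> simp [h]

/-- The sequence whose graph is decoded from `s`. -/
noncomputable def decodeSeq (s : Baire) (k : ℕ) : ℕ :=
  sInf {v | decodeNum s (Nat.pair k v + 1) % 4 = 1}

theorem decodeSeq_eq {s a : Baire}
    (hs : RepresentedSpace.IsName s (quaternary c (graphBit a))) : decodeSeq s = a := by
  funext k
  have : {v | decodeNum s (Nat.pair k v + 1) % 4 = 1} = {a k} := by
    ext v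
    exact (decodeNum_mod hs k v).trans eq_comm
  rw [decodeSeq, this, csInf_singleton]

end Quaternary

/-! ### Guessing where the rows become constant. -/

section ConstIndex

/-- The least `i` such that the word `v`, read as a prefix of some `⟨p_0, p_1, …⟩`, is consistent
with `p_i = p_{i+1} = …`. -/
noncomputable def constIndex (v : List ℕ) : ℕ :=
  sInf {i | ∀ l < v.length, i ≤ l.unpair.1 → v[Nat.pair i l.unpair.2]? = v[l]?}

theorem CompOn.constIndex {D : Set Baire} : CompOn D fun _ v => constIndex v := by
  refine CompOn.least (P := fun _ (v : List ℕ) i => ∀ l < v.length, i ≤ l.unpair.1 →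
    v[Nat.pair i l.unpair.2]? = v[l]?) ?_ fun _ _ v => ⟨v.length, fun l h1 h2 => ?_⟩
  · refine CompPredOn.forall_lt (P := fun _ (z : List ℕ × ℕ) l => z.2 ≤ l.unpair.1 →
      z.1[Nat.pair z.2 l.unpair.2]? = z.1[l]?) (n := fun _ z => z.1.length) ?_
      (CompOn.app Computable.list_length (CompOn.fst CompOn.var))
    have hv := CompOn.fst (CompOn.fst (CompOn.var (α := (List ℕ × ℕ) × ℕ) (D := D)))
    have hi := CompOn.snd (CompOn.fst (CompOn.var (α := (List ℕ × ℕ) × ℕ) (D := D)))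
    have hl := CompOn.snd (CompOn.var (α := (List ℕ × ℕ) × ℕ) (D := D))
    exact (CompPredOn.le hi hl.unpairFst).imp (CompPredOn.eq
      (CompOn.app₂ Computable.list_getElem? hv (hi.natPair hl.unpairSnd))
      (CompOn.app₂ Computable.list_getElem? hv hl))
  · exact absurd (h2.trans (Nat.unpair_left_le l)) (not_le.2 h1)

/-- Longer words only eliminate candidates, and an index from which the rows of `r` are constant is
never eliminated, so the least candidate stabilizes to such an index. -/
theorem eventually_constIndex {φ : List ℕ → List ℕ} (hφ : ∀ a b, a <+: b → φ a <+: φ b)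
    {w r s : Baire} (hr : ∀ n, ∃ m, initSeg r n <+: φ (initSeg w m))
    (hs : ∀ᶠ i in atTop, row r i = s) :
    ∃ i, (∀ᶠ m in atTop, constIndex (φ (initSeg w m)) = i) ∧ row r i = s := by
  have hword : ∀ m, φ (initSeg w m) = initSeg r (φ (initSeg w m)).length := by
    intro m
    obtain ⟨k, hk⟩ := hr (φ (initSeg w m)).length
    have h1 := hφ _ _ (initSeg_prefix w (le_max_left m k))
    have h2 := hk.trans (hφ _ _ (initSeg_prefix w (le_max_right m k)))
    have h3 := List.prefix_of_prefix_length_le h1 h2 (by rw [length_initSeg])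
    exact h3.eq_of_length (by rw [length_initSeg])
  let S : ℕ → Set ℕ := fun m => {i | ∀ l < (φ (initSeg w m)).length, i ≤ l.unpair.1 →
    r (Nat.pair i l.unpair.2) = r l}
  have hS : ∀ m, constIndex (φ (initSeg w m)) = sInf (S m) := by
    intro m
    unfold constIndex
    congr 1
    ext i
    refine forall₃_congr fun l hl hil => ?_
    -- By monotonicity of the pairing, the entry of row `i` compared with position `l` has already
    -- been read.
    have hle : Nat.pair i l.unpair.2 ≤ l := by
      conv_rhs => rw [← Nat.pair_unpair l]
      rcases hil.lt_or_eq with h | h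
      · exact (Nat.pair_lt_pair_left _ h).le
      · rw [h]
    rw [hword m, getElem?_initSeg, getElem?_initSeg, if_pos (hle.trans_lt hl), if_pos hl,
      Option.some_inj]
  have hanti : Antitone S := fun m n hmn i hi l hl =>
    hi l (hl.trans_le (hφ _ _ (initSeg_prefix w hmn)).length_le)
  obtain ⟨i₀, hi₀⟩ := eventually_atTop.1 hs
  have hne : (⋂ m, S m).Nonempty := by
    refine ⟨i₀, Set.mem_iInter.2 fun m l _ hl => ?_⟩
    have h1 := congrFun ((hi₀ i₀ le_rfl).trans (hi₀ _ hl).symm) l.unpair.2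
    simpa only [row, Nat.pair_unpair] using h1
  refine ⟨sInf (⋂ m, S m), ?_, ?_⟩
  · simp only [hS]
    exact eventually_sInf_eq_of_antitone hanti hne
  · have hmem := Nat.sInf_mem hne
    set i := sInf (⋂ m, S m)
    rw [← hi₀ (max i i₀) (le_max_right _ _)]
    funext k
    obtain ⟨m, hm⟩ := hr (Nat.pair (max i i₀) k + 1)
    have h1 := Set.mem_iInter.1 hmem m (Nat.pair (max i i₀) k)
      (by have := hm.length_le; rw [length_initSeg] at this; omega)
      (by rw [Nat.unpair_pair]; exact le_max_left _ _)
    simpa only [row, Nat.unpair_pair] using h1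

end ConstIndex

/-! ### The sequence with the coding real as its only cluster point. -/

/-- The sequence `⟨p, r_0⟩, ⟨p, r_1⟩, …` for `o = ⟨p, ⟨r_0, r_1, …⟩⟩`. -/
def pairRows (o : Baire) (n : ℕ) : Baire := pairing (left o) (row (right o) n)

/-- The constant name of the `n`-th member of a sequence of rationals, in the `n`-th row. The unique
cluster point of the sequence encodes the limit of the rows of `right o` and the last change of `γ`
along `⟨left o, lim (right o)⟩`. -/
noncomputable def clusterCode (γ : List ℕ → ℕ) (o : Baire) : Baire := fun k =>
  Nat.pair (Nat.pair (quaternaryNum (lastChange γ (pairRows o) k.unpair.1)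
    (graphBit (row (right o) k.unpair.1)) k.unpair.1) 0) (4 ^ k.unpair.1 - 1)

section

variable {α : Type*} [Primcodable α] {D : Set Baire}

theorem CompOn.rowRight {n k : Baire → α → ℕ} (hn : CompOn D n) (hk : CompOn D k) :
    CompOn D fun o x => row (Weihrauch.right o) (n o x) (k o x) := (hn.natPair hk).right

theorem CompOn.pairRows {n k : Baire → α → ℕ} (hn : CompOn D n) (hk : CompOn D k) :
    CompOn D fun o x => pairRows o (n o x) (k o x) :=
  CompOn.pairing (S := fun o _ => Weihrauch.left o)
    (T := fun o x => row (Weihrauch.right o) (n o x))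
    (CompOn.left (CompOn.snd CompOn.var))
    (CompOn.rowRight (hn.comp (CompOn.fst CompOn.var)) (CompOn.snd CompOn.var)) hk

theorem CompOn.agreement : CompOn D fun o n => agreement (Weihrauch.pairRows o) n := by
  refine CompOn.least (P := fun o n k => n ≤ k ∨
    Weihrauch.pairRows o n k ≠ Weihrauch.pairRows o (n + 1) k) ?_ fun _ _ n => ⟨n, Or.inl le_rfl⟩
  have hn := CompOn.fst (CompOn.var (α := ℕ × ℕ) (D := D))
  have hk := CompOn.snd (CompOn.var (α := ℕ × ℕ) (D := D))
  exact (CompPredOn.le hn hk).or (CompPredOn.eq (CompOn.pairRows hn hk)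
    (CompOn.pairRows (hn.add (CompOn.const 1)) hk)).not

theorem CompOn.lastChange {γ : List ℕ → ℕ} (hγ : CompOn D fun _ v => γ v) :
    CompOn D fun o n => lastChange γ (Weihrauch.pairRows o) n := by
  have hw : CompOn D fun o (z : ℕ × ℕ) => γ (initSeg (Weihrauch.pairRows o z.1) z.2) :=
    hγ.comp (CompOn.segment (T := fun o (z : ℕ × ℕ) => Weihrauch.pairRows o z.1)
      (CompOn.pairRows (CompOn.fst (CompOn.fst CompOn.var)) (CompOn.snd CompOn.var))
      (CompOn.snd CompOn.var))
  refine CompOn.least (P := fun o n c => ∀ m ≤ Weihrauch.agreement (Weihrauch.pairRows o) n, c ≤ m →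
    γ (initSeg (Weihrauch.pairRows o n) m) = γ (initSeg (Weihrauch.pairRows o n) c)) ?_
    fun _ _ _ => ⟨_, fun m h1 h2 => by rw [le_antisymm h1 h2]⟩
  refine CompPredOn.forall_le (P := fun o (z : ℕ × ℕ) m => z.2 ≤ m →
    γ (initSeg (Weihrauch.pairRows o z.1) m) = γ (initSeg (Weihrauch.pairRows o z.1) z.2)) ?_
    (CompOn.agreement.comp (CompOn.fst CompOn.var))
  have hn := CompOn.fst (CompOn.fst (CompOn.var (α := (ℕ × ℕ) × ℕ) (D := D)))
  have hc := CompOn.snd (CompOn.fst (CompOn.var (α := (ℕ × ℕ) × ℕ) (D := D)))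
  have hm := CompOn.snd (CompOn.var (α := (ℕ × ℕ) × ℕ) (D := D))
  exact (CompPredOn.le hc hm).imp (CompPredOn.eq (hw.comp (hn.pair hm)) (hw.comp (hn.pair hc)))

theorem CompOn.clusterCode {γ : List ℕ → ℕ} (hγ : CompOn D fun _ v => γ v) :
    CompOn D (clusterCode γ) := by
  have hbit : CompOn D fun o (z : ℕ × ℕ) => graphBit (row (Weihrauch.right o) z.1) z.2 :=
    CompOn.ite (CompPredOn.eq (CompOn.rowRight (CompOn.fst CompOn.var)
      (CompOn.snd CompOn.var).unpairFst) (CompOn.snd CompOn.var).unpairSnd)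
      (CompOn.const 1) (CompOn.const 0)
  have hnum : CompOn D fun o n => quaternaryNum (Weihrauch.lastChange γ (Weihrauch.pairRows o) n)
      (graphBit (row (Weihrauch.right o) n)) n :=
    CompOn.natRec (g := fun o (z : ℕ × ℕ × ℕ) =>
      4 * z.2.2 + graphBit (row (Weihrauch.right o) z.1) z.2.1) (CompOn.lastChange hγ)
      (((CompOn.const 4).mul (CompOn.snd (CompOn.snd CompOn.var))).add
        (hbit.comp ((CompOn.fst CompOn.var).pair (CompOn.fst (CompOn.snd CompOn.var))))) CompOn.var
  have hk := CompOn.unpairFst (CompOn.var (α := ℕ) (D := D))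
  exact ((hnum.comp hk).natPair (CompOn.const 0)).natPair
    (((CompOn.const 4).pow hk).sub (CompOn.const 1))

theorem CompOn.decodeNum {J : Baire → α → ℕ} (hJ : CompOn D J) :
    CompOn D fun o x => decodeNum (Weihrauch.right o) (J o x) := by
  have hs := CompOn.right (((CompOn.const 2).mul hJ).add (CompOn.const 2))
  have hk := hs.unpairSnd.add (CompOn.const 1)
  exact ((((CompOn.const 3).mul (hs.unpairFst.unpairFst.sub hs.unpairFst.unpairSnd)).mul
    ((CompOn.const 4).pow hJ)).add hk).div ((CompOn.const 3).mul hk)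

theorem CompOn.decodeSeq : CompOn {o | ∀ k, ∃ v,
    Weihrauch.decodeNum (Weihrauch.right o) (Nat.pair k v + 1) % 4 = 1}
    fun o => decodeSeq (Weihrauch.right o) :=
  CompOn.least (P := fun o k v => Weihrauch.decodeNum (Weihrauch.right o) (Nat.pair k v + 1) % 4 = 1)
    (CompPredOn.eq ((CompOn.decodeNum (((CompOn.fst CompOn.var).natPair
      (CompOn.snd CompOn.var)).add (CompOn.const 1))).mod (CompOn.const 4)) (CompOn.const 1))
    fun _ ho k => ho k

end

/-- The sequence of rationals whose codes are the rows of `clusterCode γ o`. -/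
noncomputable def clusterSeq (γ : List ℕ → ℕ) (o : Baire) (n : ℕ) : ℝ :=
  (quaternaryNum (lastChange γ (pairRows o) n) (graphBit (row (right o) n)) n : ℝ) / 4 ^ n

theorem isName_clusterSeq (γ : List ℕ → ℕ) (o : Baire) :
    RepresentedSpace.IsName (clusterCode γ o) (clusterSeq γ o) := by
  intro n
  refine isName_real_of_abs_sub_le fun k => ?_
  have h : (ratNumbering (row (clusterCode γ o) n k) : ℝ) = clusterSeq γ o n := by
    have h4 : (((4 ^ n - 1 : ℕ) : ℝ) + 1) = 4 ^ n := by
      rw [Nat.cast_sub (Nat.one_le_pow _ _ (by norm_num))]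
      simp
    simp only [row, clusterCode, clusterSeq, ratNumbering, Nat.unpair_pair]
    push_cast
    rw [h4]
    simp
  rw [h, sub_self, abs_zero]
  positivity

theorem tendsto_pairRows {p r a : Baire} (h : Tendsto (row r) atTop (𝓝 a)) :
    Tendsto (pairRows (pairing p r)) atTop (𝓝 (pairing p a)) := by
  rw [tendsto_baire_iff] at *
  intro k
  simp only [pairRows, left_pairing, right_pairing]
  unfold pairing
  split_ifs
  · exact Eventually.of_forall fun _ => rfl
  · exact h _

/-- The number `c` is the least length from which `γ` is constant along `⟨p, a⟩`; its minimality is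
what the true-stage lemmas need. -/
theorem mem_UCL_clusterSeq {γ : List ℕ → ℕ} {p r a : Baire} (h : Tendsto (row r) atTop (𝓝 a))
    {i : ℕ} (hi : ∀ᶠ m in atTop, γ (initSeg (pairing p a) m) = i) :
    ∃ c, γ (initSeg (pairing p a) c) = i ∧
      quaternary c (graphBit a) ∈ UCL ℝ (clusterSeq γ (pairing p r)) := by
  obtain ⟨N, hN⟩ := eventually_atTop.1 hi
  let S : Set ℕ := {c | ∀ m ≥ c, γ (initSeg (pairing p a) m) = γ (initSeg (pairing p a) c)}
  have hne : S.Nonempty := ⟨N, fun m hm => (hN m hm).trans (hN N le_rfl).symm⟩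
  have hc : ∀ m ≥ sInf S, γ (initSeg (pairing p a) m) = γ (initSeg (pairing p a) (sInf S)) :=
    Nat.sInf_mem hne
  have hmin : ∀ c' < sInf S, ∃ m ≥ c', γ (initSeg (pairing p a) m) ≠
      γ (initSeg (pairing p a) c') := fun c' hc' => by
    have := Nat.notMem_of_lt_sInf hc'
    simp only [S, Set.mem_ofPred_eq] at this
    push Not at this
    exact this
  refine ⟨sInf S, ?_, mem_UCL_iff.2 fun y => ?_⟩
  · rw [← hc (max N (sInf S)) (le_max_right _ _)]
    exact hN _ (le_max_left _ _)
  · have hu := tendsto_pairRows (p := p) h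
    exact mapClusterPt_quaternary_iff (a := row (right (pairing p r))) (by rwa [right_pairing])
      (frequently_lastChange_eq hu hc hmin) (eventually_lastChange hu hc hmin) y

/-! ### Reduction of a composition to `UCL ℝ`. -/

theorem reducible_of_isLimitFinMindChangeComputable {X : Type u} {Y : Type v} [RepresentedSpace X]
    [RepresentedSpace Y] {f : MultiFun X Y} (hf : IsLimitFinMindChangeComputable.{u, v, w} f) :
    WeihrauchReducible f (UCL ℝ) := by
  obtain ⟨Z, _, g, h, hg, hh, rfl⟩ := hf
  obtain ⟨Kg, Hg, hKg, hHg, hredg⟩ := weihrauchReducible_iff.1 hg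
  obtain ⟨Kh, Hh, hKh, hHh, hredh⟩ := weihrauchReducible_iff.1 hh
  let E : Set Baire := {w | (Kh w).Dom ∧ (Hg (total Kh w)).Dom}
  have hz : CompOn E (total Kh) := hKh.compOn_total.mono fun _ hw => hw.1
  have hr : CompOn E fun w => total Hg (total Kh w) :=
    hHg.compOn_total.comp_baire hz fun _ hw => hw.2
  obtain ⟨φ, hφ, hφm, hφr⟩ := hr.exists_word
  let γ : List ℕ → ℕ := fun v => constIndex (φ v)
  have hγ : ∀ D, CompOn D fun _ v => γ v := fun D => CompOn.constIndex.comp (CompOn.of_computable hφ)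
  -- `T₁` decodes `w = ⟨p, a⟩` and `c` from the answer. `T₂` recomputes the name `z = Kh w` of the
  -- intermediate point and selects row `γ (initSeg w c)` of `Hg z`, the discrete limit needed by
  -- `Kg`.
  let T₁ : Baire → Baire := fun o => pairing (pairing (left o) (decodeSeq (right o)))
    fun _ => decodeNum (right o) 0
  let T₂ : Baire → Baire := fun o => pairing (total Kh (left o)) fun k =>
    total Hg (total Kh (left o)) (Nat.pair (γ (initSeg (left o) (right o 0))) k)
  let D₁ : Set Baire := {o | ∀ k, ∃ v, decodeNum (right o) (Nat.pair k v + 1) % 4 = 1}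
  have hT₁ : CompOn D₁ T₁ := ((CompOn.left CompOn.var).pairing_baire CompOn.decodeSeq).pairing_baire
    (CompOn.decodeNum (CompOn.const 0))
  have hT₂ : CompOn {o | left o ∈ E} T₂ := by
    have hl : CompOn {o | left o ∈ E} left := CompOn.left CompOn.var
    refine (hz.comp_baire hl fun _ ho => ho).pairing_baire ?_
    refine CompOn.comp (T := fun o => total Hg (total Kh (left o)))
      (hr.comp_baire hl fun _ ho => ho) (CompOn.natPair ?_ CompOn.var)
    exact (hγ _).comp (CompOn.segment (T := fun o (_ : ℕ) => left o)
      (CompOn.left (CompOn.snd CompOn.var)) (CompOn.right (CompOn.const 0)))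
  let D : Set Baire := {o | o ∈ D₁ ∧ left (T₁ o) ∈ E ∧ (Kg (T₂ (T₁ o))).Dom}
  refine weihrauchReducible_iff.2 ⟨fun o => ⟨o ∈ D, fun _ => total Kg (T₂ (T₁ o))⟩,
    fun p => ⟨p ∈ {p | (Hh p).Dom}, fun _ => clusterCode γ (pairing p (total Hh p))⟩, ?_, ?_, ?_⟩
  · refine CompOn.isComputable (hKg.compOn_total.comp_baire (S := fun o => T₂ (T₁ o)) ?_
      fun o ho => ho.2.2)
    exact hT₂.comp_baire (hT₁.mono fun o ho => ho.1) fun o ho => ho.2.1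
  · exact CompOn.isComputable ((CompOn.clusterCode (hγ Set.univ)).comp_baire
      (CompOn.oracle.pairing_baire hHh.compOn_total) fun _ _ => Set.mem_univ _)
  · rintro p x hp ⟨_, hdom, z₀, hz₀, -⟩
    obtain ⟨r, hr, _, ⟨a, ha⟩, rfl, hredh⟩ := hredh p x hp ⟨z₀, hz₀⟩
    obtain ⟨z, hz, ζ, hζ, hzζ⟩ := hredh a a ha rfl
    -- The domain of the composition enters here: whichever `ζ ∈ h x` is named by `z`, it lies in
    -- the domain of `g`.
    obtain ⟨r', hr', _, ⟨s, hs⟩, rfl, hredg⟩ := hredg z ζ hzζ (hdom hζ)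
    obtain ⟨q, hq, y, hy, hqy⟩ := hredg s s hs rfl
    have ez := total_eq hz
    have er' : total Hg z = r' := total_eq hr'
    have hE : pairing p a ∈ E :=
      ⟨Part.dom_iff_mem.2 ⟨z, hz⟩, by rw [ez]; exact Part.dom_iff_mem.2 ⟨r', hr'⟩⟩
    obtain ⟨i, hi, hrow⟩ := eventually_constIndex hφm (r := r')
      (fun n => by rw [← er', ← ez]; exact hφr _ hE n) (tendsto_discrete_iff.1 hs)
    obtain ⟨c, hc, hcl⟩ := mem_UCL_clusterSeq (γ := γ) (p := p) ha hi
    have hd : (Hh p).Dom := Part.dom_iff_mem.2 ⟨r, hr⟩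
    refine ⟨clusterCode γ (pairing p r), ⟨hd, by
      dsimp only; rw [total_eq hr]⟩, _, ⟨_, hcl⟩, isName_clusterSeq _ _, ?_⟩
    intro t y' hy' ht
    have e : y' = quaternary c (graphBit a) := (mem_UCL_iff.1 hcl y').1 ((mem_UCL_iff.1 hy' y').2 rfl)
    rw [e] at ht
    have e₁ : T₁ (pairing p t) = pairing (pairing p a) fun _ => c := by
      simp only [T₁, left_pairing, right_pairing, decodeSeq_eq ht,
        decodeNum_eq (graphBit_le a) ht 0]
      rfl
    have e₂ : T₂ (T₁ (pairing p t)) = pairing z s := by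
      simp only [e₁, T₂, left_pairing, right_pairing, hc, ez, er']
      rw [← hrow]
      rfl
    have hD : pairing p t ∈ D := by
      refine ⟨fun k => ⟨a k, ?_⟩, ?_, ?_⟩
      · rw [right_pairing, decodeNum_mod ht]
      · rw [e₁, left_pairing]
        exact hE
      · rw [e₂]
        exact Part.dom_iff_mem.2 ⟨q, hq⟩
    refine ⟨q, ⟨hD, ?_⟩, y, ⟨hdom, ζ, hζ, hy⟩, hqy⟩
    dsimp only
    rw [e₂, total_eq hq]

theorem weihrauchReducible_refl {X Y : Type*} [RepresentedSpace X] [RepresentedSpace Y]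
    (f : MultiFun X Y) : WeihrauchReducible f f := by
  refine weihrauchReducible_iff.2 ⟨_, _, (CompOn.right CompOn.var (D := Set.univ)).isComputable,
    (CompOn.oracle (D := Set.univ)).isComputable, fun p x hp hx =>
    ⟨p, ⟨Set.mem_univ _, rfl⟩, x, hx, hp, fun s t ht hs => ⟨s, ⟨Set.mem_univ _, ?_⟩, t, ht, hs⟩⟩⟩
  exact right_pairing p s

end Weihrauch

theorem mainTheorem6 {X : Type u} {Y : Type v} [Weihrauch.RepresentedSpace X]
    [Weihrauch.RepresentedSpace Y] (f : Weihrauch.MultiFun X Y) :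
    (Weihrauch.WeihrauchReducible f (Weihrauch.UCL ℝ) ↔
      Weihrauch.IsLimitFinMindChangeComputable.{u, v, w} f) ∧
    Weihrauch.IsLimitFinMindChangeComputable.{0, 0, w} (Weihrauch.UCL ℝ) :=
  ⟨⟨Weihrauch.isLimitFinMindChangeComputable_of_reducible,
    Weihrauch.reducible_of_isLimitFinMindChangeComputable⟩,
    Weihrauch.isLimitFinMindChangeComputable_of_reducible (Weihrauch.weihrauchReducible_refl _)⟩
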